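/- **Theorem 1.3.** Let $\mathbb F$ be an algebraically closed field of characteristic $0$ and let $A$ be an associative $\mathbb F$-algebra (not necessarily unital, of arbitrary dimension) containing a non-zero semisimple finite dimensional subalgebra $S$. Suppose that $A$ is generated by $S$ as an ideal and that $S$ is $1$-perfect, i.e. $S$ has no proper ideals of codimension $\le 1$. Let $A^{(1)}=[A,A]$ and $\mathfrak g=S^{(1)}=[S,S]$ be the Lie algebras spanned by the commutators $xy-yx$ of elements of $A$ and of $S$, respectively. Then $\mathfrak g$ has a Cartan subalgebra, and for every Cartan subalgebra $\mathfrak h$ of $\mathfrak g$ the following holds. Let $\Delta\subset\mathfrak h^*$ be the set of roots of $\mathfrak g$, and let $Q_1,\dots,Q_t$ be the simple components of $\mathfrak g$. Each $Q_i$ is the commutator algebra of a simple component $S_i\cong M_{n_i}(\mathbb F)$ of $S$; its natural module is $\mathbb F^{n_i}$, its conatural module is the dual of the natural one, and the other components act on both as zero. Let $\Gamma\subset\mathfrak h^*$ consist of the elements of $\Delta$ and all $\lambda_i+\lambda_j$ with $0\le i<j\le t$, where $\lambda_0=0$ and, for $i\ge1$, $\lambda_i$ is either zero or a weight of the natural or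 conatural $Q_i$-module. Then the Lie algebra $L=A^{(1)}$ is $(\Gamma,\mathfrak g)$-graded, that is: * $\Gamma$ is a finite set of integral weights of $\Delta$ containing $\Delta$ and $0$; * $\mathfrak g$ is a subalgebra of $L$ which is finite dimensional split semisimple, with split Cartan subalgebra $\mathfrak h=\mathfrak g_0$ and $\mathfrak g=\mathfrak h\oplus\bigoplus_{\alpha\in\Delta}\mathfrak g_\alpha$; * $L=\bigoplus_{\alpha\in\Gamma}L_\alpha$, where $L_\alpha=\{x\in L\mid [h,x]=\alpha(h)x\text{ for all }h\in\mathfrak h\}$; * $L_0=\sum_{\alpha,-\alpha\in\Gamma\setminus\{0\}}[L_\alpha,L_{-\alpha}]$. -/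

import Mathlib

/-! ### The Lie algebra of an associative algebra without assumed identity -/

/-- The Lie ring `A⁽⁻⁾` of a (not necessarily unital) associative ring, with `⁅x, y⁆ = x * y - y * x`. -/
@[reducible] def commutatorLieRing (A : Type*) [NonUnitalRing A] : LieRing A where
  add_lie x y z := by simp only [Ring.lie_def, add_mul, mul_add]; abel
  lie_add x y z := by simp only [Ring.lie_def, add_mul, mul_add]; abel
  lie_self x := by simp only [Ring.lie_def, sub_self]
  leibniz_lie x y z := by
    simp only [Ring.lie_def, mul_sub, sub_mul, mul_assoc]; abel

attribute [local instance 100] commutatorLieRing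

/-- The Lie algebra `A⁽⁻⁾` of a (not necessarily unital) associative algebra. -/
@[reducible] def commutatorLieAlgebra (F A : Type*) [Field F] [NonUnitalRing A] [Module F A]
    [IsScalarTower F A A] [SMulCommClass F A A] : LieAlgebra F A where
  lie_smul t x y := by
    simp only [Ring.lie_def, mul_smul_comm, smul_mul_assoc, smul_sub]

attribute [local instance 100] commutatorLieAlgebra

/-- The derived subalgebra `[K, K]` of a Lie subalgebra `K`: the span of all `⁅x, y⁆`, `x, y ∈ K`. -/
def derivedLieSubalgebra {F L : Type*} [Field F] [LieRing L] [LieAlgebra F L]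
    (K : LieSubalgebra F L) : LieSubalgebra F L where
  toSubmodule := Submodule.span F {z | ∃ x ∈ K, ∃ y ∈ K, ⁅x, y⁆ = z}
  lie_mem' := by
    intro a b ha hb
    have hK : Submodule.span F {z | ∃ x ∈ K, ∃ y ∈ K, ⁅x, y⁆ = z} ≤ K.toSubmodule := by
      rw [Submodule.span_le]
      rintro _ ⟨x, hx, y, hy, rfl⟩
      exact K.lie_mem hx hy
    exact Submodule.subset_span ⟨a, hK ha, b, hK hb, rfl⟩

/-! ### Ideals, perfectness and semisimplicity of associative algebras -/

section Associative

variable (F : Type*) [Field F] {B : Type*} [NonUnitalRing B] [Module F B]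

/-- A subspace `I` of the algebra `B` is a (two-sided) ideal. -/
def IsAlgIdeal (I : Submodule F B) : Prop :=
  ∀ b : B, ∀ x ∈ I, b * x ∈ I ∧ x * b ∈ I

/-- `B` is `k`-perfect: it has no proper ideal of codimension at most `k`. -/
def IsKPerfect (B : Type*) [NonUnitalRing B] [Module F B] (k : ℕ) : Prop :=
  ∀ I : Submodule F B, IsAlgIdeal F I → I ≠ ⊤ → ¬ Module.rank F (B ⧸ I) ≤ (k : Cardinal)

/-- `idealPow F I m` is the power `I ^ (m + 1)`, the span of all products of `m + 1` elements
of `I`. -/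
def idealPow (I : Submodule F B) : ℕ → Submodule F B
  | 0 => I
  | m + 1 => Submodule.span F {z | ∃ x ∈ idealPow I m, ∃ y ∈ I, x * y = z}

/-- Semisimplicity of a finite dimensional algebra `B`: its radical (the largest nilpotent ideal)
is zero, i.e. every nilpotent ideal of `B` is zero. -/
def IsSemisimpleAlg (B : Type*) [NonUnitalRing B] [Module F B] : Prop :=
  ∀ I : Submodule F B, IsAlgIdeal F I → (∃ m : ℕ, idealPow F I m = ⊥) → I = ⊥

/-- The algebra `B` is generated, as an ideal, by the subset `X`. -/
def GeneratedAsIdeal (X : Set B) : Prop :=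
  ∀ I : Submodule F B, IsAlgIdeal F I → X ⊆ I → I = ⊤

end Associative

/-! ### Graded Lie algebras -/

section Graded

variable {F L : Type*} [Field F] [LieRing L] [LieAlgebra F L]

/-- The simultaneous eigenspace `{x ∈ M | ⁅h, x⁆ = α h • x for all h ∈ H}`. -/
def eigSpace {H : Type*} (M : Type*) [LieRing H] [LieAlgebra F H] [AddCommGroup M] [Module F M]
    [LieRingModule H M] [LieModule F H M] (α : Module.Dual F H) : Submodule F M where
  carrier := {x | ∀ h : H, ⁅h, x⁆ = α h • x}
  zero_mem' := fun h => by simp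
  add_mem' := fun {x y} hx hy h => by rw [lie_add, hx h, hy h, smul_add]
  smul_mem' := fun c x hx h => by rw [lie_smul, hx h, smul_comm]

/-- The roots of a Lie algebra `L` relative to a subalgebra `𝔥`. -/
def rootSet (𝔥 : LieSubalgebra F L) : Set (Module.Dual F 𝔥) :=
  {α | α ≠ 0 ∧ eigSpace L α ≠ ⊥}

/-- `h ∈ 𝔥` is the coroot of `α`: it completes to an `sl₂`-triple `(h, e, f)` with `e` in the
root space of `α` and `f` in the root space of `-α`. -/
def IsCorootOf (𝔥 : LieSubalgebra F L) (α : Module.Dual F 𝔥) (h : 𝔥) : Prop :=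
  ∃ e ∈ eigSpace L α, ∃ f ∈ eigSpace L (-α), IsSl2Triple (h : L) e f

/-- `μ` is an integral weight: it takes integer values on all coroots. -/
def IsIntegralWeight (𝔥 : LieSubalgebra F L) (μ : Module.Dual F 𝔥) : Prop :=
  ∀ α ∈ rootSet 𝔥, ∀ h : 𝔥, IsCorootOf 𝔥 α h → ∃ m : ℤ, μ h = m

/-- `L` is finite dimensional semisimple with split Cartan subalgebra `𝔥`:
`L = 𝔥 ⊕ ⨁ L_α`, the sum over the roots, and `𝔥 = L_0`. -/
structure IsSplitSemisimple (𝔥 : LieSubalgebra F L) : Prop where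
  finiteDimensional : FiniteDimensional F L
  semisimple : LieAlgebra.IsSemisimple F L
  cartan : 𝔥.IsCartanSubalgebra
  eigSpace_zero : eigSpace L (0 : Module.Dual F 𝔥) = 𝔥.toSubmodule
  independent : iSupIndep fun α : ↥({0} ∪ rootSet 𝔥) => eigSpace L α.1
  iSup_eq_top : ⨆ α : ↥({0} ∪ rootSet 𝔥), eigSpace L α.1 = ⊤

/-- `L` is `(Γ, 𝔤)`-graded, relative to the split Cartan subalgebra `𝔥` of its subalgebra `𝔤`
(over a field of characteristic zero). -/
structure IsRootGraded (𝔤 : LieSubalgebra F L) (𝔥 : LieSubalgebra F 𝔤)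
    (Γ : Set (Module.Dual F 𝔥)) : Prop where
  /-- `Γ` is a finite set of integral weights containing the root system and zero. -/
  finite : Γ.Finite
  integral : ∀ μ ∈ Γ, IsIntegralWeight 𝔥 μ
  root_mem : rootSet 𝔥 ⊆ Γ
  zero_mem : (0 : Module.Dual F 𝔥) ∈ Γ
  /-- `𝔤` is a finite dimensional split semisimple Lie algebra. -/
  splitSemisimple : IsSplitSemisimple 𝔥
  /-- `L` is the direct sum of the `L_α`, `α ∈ Γ`. -/
  independent : iSupIndep fun α : Γ => eigSpace L α.1
  iSup_eq_top : ⨆ α : Γ, eigSpace L α.1 = ⊤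
  /-- `L_0` is the sum of the `⁅L_α, L_{-α}⁆` over `α` with `α, -α ∈ Γ \ {0}`. -/
  zero_space : eigSpace L (0 : Module.Dual F 𝔥) =
    Submodule.span F {z | ∃ α ∈ Γ \ {0}, -α ∈ Γ \ {0} ∧
      ∃ x ∈ eigSpace L α, ∃ y ∈ eigSpace L (-α), ⁅x, y⁆ = z}

end Graded

/-! ### The Lie algebras `A⁽¹⁾` and `S⁽¹⁾`, and the weights -/

section Main

variable {F A : Type*} [Field F] [NonUnitalRing A] [Module F A]
  [IsScalarTower F A A] [SMulCommClass F A A]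

/-- A subalgebra of `A` as a Lie subalgebra of `A⁽⁻⁾`. -/
def NonUnitalSubalgebra.asLieSubalgebra (S : NonUnitalSubalgebra F A) : LieSubalgebra F A where
  toSubmodule := S.toSubmodule
  lie_mem' := fun {x y} hx hy => by
    rw [Ring.lie_def]
    have h1 : x * y ∈ S.toSubmodule := S.mul_mem' hx hy
    have h2 : y * x ∈ S.toSubmodule := S.mul_mem' hy hx
    exact sub_mem h1 h2

variable (F A) in
/-- `A⁽¹⁾ = [A⁽⁻⁾, A⁽⁻⁾]`. -/
def algCommutator : LieSubalgebra F A := derivedLieSubalgebra ⊤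

/-- `S⁽¹⁾ = [S, S]` as a subalgebra of the Lie algebra `A⁽¹⁾`. -/
def subCommutator (S : NonUnitalSubalgebra F A) : LieSubalgebra F (algCommutator F A) :=
  (derivedLieSubalgebra S.asLieSubalgebra).comap (algCommutator F A).incl

/-- The inclusion of `S⁽¹⁾` in `S`. -/
def subCommutatorToS (S : NonUnitalSubalgebra F A) (x : subCommutator S) : S :=
  ⟨((x : algCommutator F A) : A), by
    have h : Submodule.span F {z | ∃ x ∈ S.asLieSubalgebra, ∃ y ∈ S.asLieSubalgebra, ⁅x, y⁆ = z} ≤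
        S.toSubmodule := by
      rw [Submodule.span_le]
      rintro _ ⟨x, hx, y, hy, rfl⟩
      exact S.asLieSubalgebra.lie_mem hx hy
    exact h x.2⟩

/-- `ρ` realizes `F ^ n` as the natural `Q`-module of the component `Q` of `S⁽¹⁾`: `ρ` is an algebra
homomorphism of `S` onto the `n × n` matrices (the projection of `S` onto a simple component,
identified with the matrix algebra) that identifies `Q` with `sl n F`. -/
def IsNaturalRep (S : NonUnitalSubalgebra F A) (Q : LieIdeal F (subCommutator S)) (n : ℕ)
    (ρ : S →ₙₐ[F] Matrix (Fin n) (Fin n) F) : Prop :=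
  Function.Surjective ρ ∧
  Set.BijOn (fun x : subCommutator S => ρ (subCommutatorToS S x)) (Q : Set (subCommutator S))
    (LieAlgebra.SpecialLinear.sl (Fin n) F : Set (Matrix (Fin n) (Fin n) F))

/-- The weights, relative to `𝔥`, of the natural `Q`-module `F ^ n` (column vectors, on which the
other components of `S⁽¹⁾` act as zero). -/
def naturalWeights (S : NonUnitalSubalgebra F A) (𝔥 : LieSubalgebra F (subCommutator S))
    (Q : LieIdeal F (subCommutator S)) : Set (Module.Dual F 𝔥) :=
  {μ | ∃ (n : ℕ) (ρ : S →ₙₐ[F] Matrix (Fin n) (Fin n) F), IsNaturalRep S Q n ρ ∧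
    ∃ v : Fin n → F, v ≠ 0 ∧
      ∀ h : 𝔥, Matrix.mulVec (ρ (subCommutatorToS S h)) v = μ h • v}

/-- The weights, relative to `𝔥`, of the conatural `Q`-module, i.e. of the dual of the natural one
(row vectors, with `x` acting as `v ↦ - v x`). -/
def conaturalWeights (S : NonUnitalSubalgebra F A) (𝔥 : LieSubalgebra F (subCommutator S))
    (Q : LieIdeal F (subCommutator S)) : Set (Module.Dual F 𝔥) :=
  {μ | ∃ (n : ℕ) (ρ : S →ₙₐ[F] Matrix (Fin n) (Fin n) F), IsNaturalRep S Q n ρ ∧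
    ∃ v : Fin n → F, v ≠ 0 ∧
      ∀ h : 𝔥, -Matrix.vecMul v (ρ (subCommutatorToS S h)) = μ h • v}

/-- Zero and the weights of the natural and conatural `Q`-modules. -/
def componentWeights (S : NonUnitalSubalgebra F A) (𝔥 : LieSubalgebra F (subCommutator S))
    (Q : LieIdeal F (subCommutator S)) : Set (Module.Dual F 𝔥) :=
  {0} ∪ naturalWeights S 𝔥 Q ∪ conaturalWeights S 𝔥 Q

/-- The set `Γ`: the roots of `S⁽¹⁾`, all `μ` and all sums `μ + ν`, where `μ` and `ν` are in the
component weights of two different simple components (minimal ideals) `Q`, `Q'` of `S⁽¹⁾`.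
The single `μ` matter only if there is just one simple component. -/
def gradingWeights (S : NonUnitalSubalgebra F A) (𝔥 : LieSubalgebra F (subCommutator S)) :
    Set (Module.Dual F 𝔥) :=
  rootSet 𝔥 ∪
  {μ | ∃ Q : LieIdeal F (subCommutator S), IsAtom Q ∧ μ ∈ componentWeights S 𝔥 Q} ∪
  {γ | ∃ Q Q' : LieIdeal F (subCommutator S), IsAtom Q ∧ IsAtom Q' ∧ Q ≠ Q' ∧
    ∃ μ ∈ componentWeights S 𝔥 Q, ∃ ν ∈ componentWeights S 𝔥 Q', γ = μ + ν}

end Main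

/-! Wedderburn's theorem, applied after adjoining an identity, makes `S` a product of matrix
algebras. Since `S` is `1`-perfect, no factor has size one, so `S⁽¹⁾` is a product of `sl n` with
all `n ≥ 2`. The elements of a Cartan subalgebra `𝔥` act semisimply on the natural modules: the
nilpotent part of a coordinate lifts to an ad-nilpotent element of `𝔥`, which must vanish. Hence `𝔥`
is diagonal in suitable matrix coordinates (`exists_diagonal_coordinates`).

The diagonal matrix units `e_p`, with the diagonal entries `ε_p` of `𝔥` as weights, and the formal
complement `1 - ∑ e_p` of weight zero give a Peirce decomposition of `A`. On its `(i, j)` piece `𝔥`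
acts by `ε_i - ε_j`, which always lies in `Γ` (`peirceWeight_sub_mem`). A piece of nonzero weight
consists of multiples of commutators with elements of `𝔥`, hence lies in `A⁽¹⁾`; this gives the
decomposition of `A⁽¹⁾`.

For `L_0`, the point is that each component has two different diagonal weights. So for any `γ` the
`e_p` of weight other than `γ` still generate `A` as an ideal, and elements of weight zero are sums
of products `b * c` of opposite nonzero weights (`mem_span_mul_of_mem_zero`). For `y` of weight
zero, `[bc, y] = [b, cy] - [yb, c]` rewrites commutators inside the zero space through opposite
nonzero weights (`zeroProj_comm_mem`). Integrality of `Γ` is `sl₂`-theory. -/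

/-! ### Traceless matrices -/

section Traceless

variable {F m : Type*} [Field F] [Fintype m] [DecidableEq m]

open Matrix in
/-- The traceless matrices are spanned by the off-diagonal matrix units and the differences of the
diagonal ones. -/
theorem mem_of_trace_eq_zero {W : Submodule F (Matrix m m F)}
    (hoff : ∀ k l, k ≠ l → single k l (1 : F) ∈ W)
    (hdiag : ∀ k l, single k k (1 : F) - single l l 1 ∈ W)
    {X : Matrix m m F} (hX : X.trace = 0) : X ∈ W := by
  rcases isEmpty_or_nonempty m with hm | ⟨⟨o⟩⟩
  · rw [Subsingleton.elim X 0]; exact zero_mem _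
  -- The corrections at the fixed position `o` add up to the trace of `X`, so they change nothing.
  have key : X = ∑ k, ∑ l, X k l • (single k l (1 : F) - if k = l then single o o 1 else 0) := by
    conv_lhs => rw [matrix_eq_sum_single X]
    simp only [smul_sub, Finset.sum_sub_distrib, smul_single, smul_eq_mul, mul_one, smul_ite,
      smul_zero, Finset.sum_ite_eq, Finset.mem_univ, if_true]
    rw [eq_comm, sub_eq_self]
    have : ∑ k, single o o (X k k) = single o o (∑ k, X k k) := by
      ext a b
      simp only [Matrix.sum_apply, single_apply]
      split_ifs <;> simp
    rw [this]
    have h0 : ∑ k, X k k = 0 := hX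
    rw [h0, single_zero]
  rw [key]
  refine Submodule.sum_mem _ fun k _ => Submodule.sum_mem _ fun l _ => Submodule.smul_mem _ _ ?_
  split_ifs with h
  · subst h; exact hdiag k o
  · simpa using hoff k l h

open Matrix in
/-- A nonzero traceless matrix has an off-diagonal entry or two distinct diagonal entries. -/
theorem exists_offDiag_or_diag_ne [CharZero F] {X : Matrix m m F} (hX : X.trace = 0)
    (hX0 : X ≠ 0) : (∃ k l, k ≠ l ∧ X l k ≠ 0) ∨
      ((∀ k l, k ≠ l → X k l = 0) ∧ ∃ k l, k ≠ l ∧ X k k ≠ X l l) := by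
  by_cases h : ∃ k l, k ≠ l ∧ X l k ≠ 0
  · exact Or.inl h
  push Not at h
  refine Or.inr ⟨fun k l hkl => h l k hkl.symm, ?_⟩
  by_contra! hd
  apply hX0
  rcases isEmpty_or_nonempty m with hm | ⟨⟨o⟩⟩
  · exact Subsingleton.elim _ _
  have hd' : ∀ k, X k k = X o o := fun k => by
    by_cases hk : k = o
    · rw [hk]
    · exact hd k o hk
  have ht : (Fintype.card m : F) * X o o = 0 := by
    rw [← hX, Matrix.trace]
    simp [Matrix.diag, hd']
  have hc : (Fintype.card m : F) ≠ 0 := by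
    have : Nonempty m := ⟨o⟩
    exact_mod_cast Fintype.card_ne_zero
  have h0 : X o o = 0 := (mul_eq_zero.mp ht).resolve_left hc
  ext k l
  by_cases hkl : k = l
  · subst hkl; simp [hd', h0]
  · simp [h l k (Ne.symm hkl)]

-- A matrix unit `E` off the diagonal squares to zero, so `(ad E)²` is `X ↦ -2 E X E`, and `E X E`
-- is a multiple of `E`. One nonzero off-diagonal entry thus suffices to extract a matrix unit.
open Matrix in
theorem double_comm_single {k l : m} (hkl : k ≠ l) (X : Matrix m m F) :
    single k l (1 : F) * (single k l 1 * X - X * single k l 1)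
      - (single k l 1 * X - X * single k l 1) * single k l 1
      = (-2 * X l k) • single k l 1 := by
  have h0 : single k l (1 : F) * single k l 1 = 0 := by
    rw [single_mul_single_of_ne]; exact hkl.symm
  have h1 : single k l (1 : F) * X * single k l 1 = (X l k) • single k l 1 := by
    rw [single_mul_mul_single]; simp
  calc _ = single k l (1 : F) * single k l 1 * X - 2 • (single k l (1 : F) * X * single k l 1)
        + X * (single k l (1 : F) * single k l 1) := by noncomm_ring
    _ = _ := by rw [h0, h1, ← Nat.cast_smul_eq_nsmul F]; simp [neg_smul, mul_smul]

open Matrix in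
theorem comm_single_of_diagonal {X : Matrix m m F} (hX : ∀ k l, k ≠ l → X k l = 0) (k l : m) :
    single k l (1 : F) * X - X * single k l 1 = (X l l - X k k) • single k l 1 := by
  have hd : X = diagonal fun i => X i i := by
    ext i j
    by_cases h : i = j
    · subst h; simp
    · simp [h, hX i j h]
  rw [hd]
  ext i j
  simp only [Matrix.sub_apply, mul_diagonal, diagonal_mul, Matrix.smul_apply, single_apply,
    smul_eq_mul, diagonal_apply_eq]
  split_ifs with h
  · obtain ⟨rfl, rfl⟩ := h; ring
  · simp

open Matrix in
/-- A nonzero traceless matrix does not centralize the off-diagonal matrix units. -/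
theorem exists_comm_single_ne_zero [CharZero F] {X : Matrix m m F} (hX : X.trace = 0)
    (hX0 : X ≠ 0) : ∃ k l, k ≠ l ∧ single k l (1 : F) * X - X * single k l 1 ≠ 0 := by
  rcases exists_offDiag_or_diag_ne hX hX0 with ⟨k, l, hkl, h⟩ | ⟨hd, k, l, hkl, h⟩
  · refine ⟨k, l, hkl, fun h0 => h ?_⟩
    have := double_comm_single hkl X
    rw [h0] at this
    simpa using congrFun (congrFun this k) l
  · refine ⟨k, l, hkl, fun h0 => h ?_⟩
    rw [comm_single_of_diagonal hd] at h0
    have := congrFun (congrFun h0 k) l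
    simp [sub_eq_zero] at this
    exact this.symm

open Matrix in
/-- A subspace stable under commutation with traceless matrices and containing a nonzero traceless
matrix contains all of them: `sl` is a simple Lie algebra. -/
theorem mem_of_stable_of_trace_eq_zero [CharZero F] {W : Submodule F (Matrix m m F)}
    (hW : ∀ Y : Matrix m m F, Y.trace = 0 → ∀ X ∈ W, Y * X - X * Y ∈ W)
    {X : Matrix m m F} (hXW : X ∈ W) (hX : X.trace = 0) (hX0 : X ≠ 0)
    {Z : Matrix m m F} (hZ : Z.trace = 0) : Z ∈ W := by
  have htr : ∀ k l : m, k ≠ l → (single k l (1 : F)).trace = 0 := fun k l hkl =>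
    trace_single_eq_of_ne k l 1 hkl
  have hcomm : ∀ k l, k ≠ l → ∀ X ∈ W, single k l (1 : F) * X - X * single k l 1 ∈ W :=
    fun k l hkl => hW _ (htr k l hkl)
  have hstart : ∃ k l, k ≠ l ∧ single k l (1 : F) ∈ W := by
    rcases exists_offDiag_or_diag_ne hX hX0 with ⟨k, l, hkl, h⟩ | ⟨hd, k, l, hkl, h⟩
    · refine ⟨k, l, hkl, ?_⟩
      have h2 := hcomm k l hkl _ (hcomm k l hkl X hXW)
      rw [double_comm_single hkl] at h2
      exact (Submodule.smul_mem_iff _ (mul_ne_zero (by norm_num) h)).mp h2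
    · refine ⟨k, l, hkl, ?_⟩
      have h2 := hcomm k l hkl X hXW
      rw [comm_single_of_diagonal hd] at h2
      exact (Submodule.smul_mem_iff _ (sub_ne_zero.mpr (Ne.symm h))).mp h2
  have hswap : ∀ k l, k ≠ l → single k l (1 : F) ∈ W → single l k (1 : F) ∈ W := by
    intro k l hkl h
    have h2 := hcomm l k hkl.symm _ (hcomm l k hkl.symm _ h)
    rw [double_comm_single hkl.symm] at h2
    refine (Submodule.smul_mem_iff _ ?_).mp h2
    simp
  have hright : ∀ k l r, k ≠ l → k ≠ r → single k l (1 : F) ∈ W → single k r (1 : F) ∈ W := by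
    intro k l r hkl hkr h
    by_cases hlr : l = r
    · exact hlr ▸ h
    have h2 := hcomm l r hlr _ h
    rw [single_mul_single_of_ne _ _ _ _ (Ne.symm hkr), single_mul_single_same] at h2
    simpa using h2
  have hleft : ∀ k l r, k ≠ l → r ≠ l → single k l (1 : F) ∈ W → single r l (1 : F) ∈ W :=
    fun k l r hkl hrl h => hswap _ _ hrl.symm (hright _ _ _ hkl.symm hrl.symm (hswap _ _ hkl h))
  obtain ⟨k, l, hkl, h⟩ := hstart
  have hoff : ∀ a b, a ≠ b → single a b (1 : F) ∈ W := by
    intro a b hab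
    -- The route `(k, l) → (k, b) → (a, b)` would pass through the diagonal when `b = k`; in that
    -- case it starts from `(l, k)`.
    by_cases hbk : b = k
    · subst hbk
      exact hleft l b a hkl.symm hab (hswap _ _ hkl h)
    · exact hleft k b a (Ne.symm hbk) hab (hright k l b hkl (Ne.symm hbk) h)
  refine mem_of_trace_eq_zero hoff (fun a b => ?_) hZ
  by_cases hab : a = b
  · simp [hab]
  have := hcomm a b hab _ (hoff b a (Ne.symm hab))
  simpa using this

end Traceless

/-! ### Direct sums of special linear Lie algebras -/

/-- `θ` identifies the Lie algebra `𝔤` with the product of the special linear Lie algebras of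
traceless matrices. -/
structure IsSlCoordinates {F 𝔤 ι : Type*} [Field F] [LieRing 𝔤] [LieAlgebra F 𝔤] {n : ι → ℕ}
    (θ : 𝔤 →ₗ[F] Π i, Matrix (Fin (n i)) (Fin (n i)) F) : Prop where
  map_lie : ∀ x y i, θ ⁅x, y⁆ i = θ x i * θ y i - θ y i * θ x i
  injective : Function.Injective θ
  trace_eq_zero : ∀ x i, (θ x i).trace = 0
  exists_eq : ∀ X, (∀ i, (X i).trace = 0) → ∃ x, θ x = X

namespace IsSlCoordinates

variable {F 𝔤 ι : Type*} [Field F] [LieRing 𝔤] [LieAlgebra F 𝔤] {n : ι → ℕ}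
  {θ : 𝔤 →ₗ[F] Π i, Matrix (Fin (n i)) (Fin (n i)) F}

/-- The ideal of `𝔤` supported on the component `i`. -/
def component (hθ : IsSlCoordinates θ) (i : ι) : LieIdeal F 𝔤 where
  carrier := {x | ∀ j, j ≠ i → θ x j = 0}
  zero_mem' := fun j _ => by simp
  add_mem' := fun {x y} hx hy j hj => by simp [hx j hj, hy j hj]
  smul_mem' := fun c x hx j hj => by simp [hx j hj]
  lie_mem := fun {x y} hy j hj => by
    have := hy j hj
    simp [hθ.map_lie, this]

theorem ext_component (hθ : IsSlCoordinates θ) {i : ι} {x y : 𝔤} (hx : x ∈ hθ.component i)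
    (hy : y ∈ hθ.component i) (h : θ x i = θ y i) : x = y := by
  apply hθ.injective
  funext j
  by_cases hj : j = i
  · subst hj; exact h
  · rw [hx j hj, hy j hj]

theorem exists_component (hθ : IsSlCoordinates θ) {i : ι} {X : Matrix (Fin (n i)) (Fin (n i)) F}
    (hX : X.trace = 0) : ∃ x ∈ hθ.component i, θ x i = X := by
  classical
  obtain ⟨x, hx⟩ := hθ.exists_eq (Pi.single i X) fun j => by
    by_cases hj : j = i
    · subst hj; simpa using hX
    · simp [hj]
  exact ⟨x, fun j hj => by simp [hx, hj], by simp [hx]⟩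

/-- Since `sl` has no centre, some matrix unit of the component `i` has a nonzero bracket with `x`.
That bracket lies both in `I` and in the component, and simplicity of `sl` does the rest. -/
theorem component_le (hθ : IsSlCoordinates θ) [CharZero F] {I : LieIdeal F 𝔤} {x : 𝔤} (hx : x ∈ I)
    {i : ι} (hxi : θ x i ≠ 0) : hθ.component i ≤ I := by
  let W : Submodule F (Matrix (Fin (n i)) (Fin (n i)) F) :=
    (I.toSubmodule ⊓ (hθ.component i).toSubmodule).map (LinearMap.proj i ∘ₗ θ)
  have hW : ∀ Y : Matrix (Fin (n i)) (Fin (n i)) F, Y.trace = 0 → ∀ X ∈ W,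
      Y * X - X * Y ∈ W := by
    rintro Y hY _ ⟨z, ⟨hz1, hz2⟩, rfl⟩
    obtain ⟨y, -, rfl⟩ := hθ.exists_component hY
    refine ⟨⁅y, z⁆, ⟨I.lie_mem hz1, (hθ.component i).lie_mem hz2⟩, ?_⟩
    simp [hθ.map_lie]
  obtain ⟨k, l, hkl, h⟩ := exists_comm_single_ne_zero (hθ.trace_eq_zero x i) hxi
  obtain ⟨y, hy, hyi⟩ := hθ.exists_component (i := i) (Matrix.trace_single_eq_of_ne k l (1 : F) hkl)
  rw [← hyi, ← hθ.map_lie] at h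
  have hmem : θ ⁅y, x⁆ i ∈ W := by
    refine ⟨⁅y, x⁆, ⟨I.lie_mem hx, ?_⟩, rfl⟩
    exact lie_mem_left F 𝔤 (hθ.component i) y x hy
  intro z hz
  obtain ⟨w, ⟨hw1, hw2⟩, hw⟩ := mem_of_stable_of_trace_eq_zero hW hmem (hθ.trace_eq_zero _ _) h
    (hθ.trace_eq_zero z i)
  rw [hθ.ext_component hz hw2 hw.symm]
  exact hw1

theorem exists_component_single (hθ : IsSlCoordinates θ) {i : ι} {k l : Fin (n i)} (hkl : k ≠ l) :
    ∃ x ∈ hθ.component i, θ x i = Matrix.single k l 1 :=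
  hθ.exists_component (Matrix.trace_single_eq_of_ne k l (1 : F) hkl)

theorem isAtom_component (hθ : IsSlCoordinates θ) [CharZero F] {i : ι} (hi : 2 ≤ n i) :
    IsAtom (hθ.component i) := by
  constructor
  · intro h
    have h01 : (⟨0, by omega⟩ : Fin (n i)) ≠ ⟨1, by omega⟩ := by simp
    obtain ⟨x, hx, hxi⟩ := hθ.exists_component_single h01
    rw [h, LieSubmodule.mem_bot] at hx
    rw [hx] at hxi
    have := congrFun (congrFun hxi ⟨0, by omega⟩) ⟨1, by omega⟩
    simp at this
  · intro J hJ
    by_contra hne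
    obtain ⟨x, hx, hx0⟩ : ∃ x ∈ J, x ≠ 0 := by
      simpa using (LieSubmodule.eq_bot_iff J).not.mp hne
    refine hJ.not_ge (hθ.component_le hx fun h0 => hx0 ?_)
    exact hθ.ext_component (hJ.le hx) (zero_mem _) (by simpa using h0)

theorem component_injective (hθ : IsSlCoordinates θ) (hn : ∀ i, 2 ≤ n i) :
    Function.Injective hθ.component := by
  intro i j hij
  by_contra hne
  have h01 : (⟨0, by have := hn i; omega⟩ : Fin (n i)) ≠ ⟨1, by have := hn i; omega⟩ := by simp
  obtain ⟨x, hx, hxi⟩ := hθ.exists_component_single h01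
  rw [hij] at hx
  have h0 := hx i hne
  rw [hxi] at h0
  have := congrFun (congrFun h0 ⟨0, by have := hn i; omega⟩) ⟨1, by have := hn i; omega⟩
  simp at this

/-- A nonzero abelian ideal would contain a whole component, and there the units at `(k, l)` and
`(l, k)` do not commute. -/
theorem hasTrivialRadical (hθ : IsSlCoordinates θ) [CharZero F] :
    LieAlgebra.HasTrivialRadical F 𝔤 := by
  rw [LieAlgebra.hasTrivialRadical_iff_no_abelian_ideals]
  intro I hI
  by_contra hne
  obtain ⟨x, hx, hx0⟩ : ∃ x ∈ I, x ≠ 0 := by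
    simpa using (LieSubmodule.eq_bot_iff I).not.mp hne
  have : ∃ i, θ x i ≠ 0 := by
    by_contra! h
    exact hx0 (hθ.injective (by rw [map_zero]; exact funext h))
  obtain ⟨i, hi⟩ := this
  have hle := hθ.component_le hx hi
  obtain ⟨k, l, hkl, -⟩ := exists_comm_single_ne_zero (hθ.trace_eq_zero x i) hi
  obtain ⟨y, hy, hyi⟩ := hθ.exists_component_single hkl
  obtain ⟨z, hz, hzi⟩ := hθ.exists_component_single hkl.symm
  have h0 : (⁅(⟨y, hle hy⟩ : I), (⟨z, hle hz⟩ : I)⁆ : I) = 0 := hI.trivial _ _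
  have h1 : ⁅y, z⁆ = 0 := congrArg Subtype.val h0
  have h2 := hθ.map_lie y z i
  rw [h1, hyi, hzi] at h2
  have := congrFun (congrFun h2 k) k
  simp [hkl.symm] at this

end IsSlCoordinates

/-! ### Simultaneous diagonalization -/

/-- A commuting family of semisimple endomorphisms has a basis of common eigenvectors. -/
theorem exists_basis_common_eigenvectors {F V ι : Type*} [Field F] [IsAlgClosed F]
    [AddCommGroup V] [Module F V] [FiniteDimensional F V] (f : ι → Module.End F V)
    (hcomm : ∀ i j, Commute (f i) (f j)) (hss : ∀ i, (f i).IsSemisimple) {d : ℕ}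
    (hd : Module.finrank F V = d) :
    ∃ b : Module.Basis (Fin d) F V, ∀ i k, ∃ c : F, f i (b k) = c • b k := by
  let s : Set V := {v | ∀ i, ∃ c : F, f i v = c • v}
  have hs : ⊤ ≤ Submodule.span F s := by
    -- Commuting operators over an algebraically closed field have joint generalized eigenspaces
    -- that span; semisimplicity turns these into joint eigenspaces.
    rw [← Module.End.iSup_iInf_maxGenEigenspace_eq_top_of_iSup_maxGenEigenspace_eq_top_of_commute f
      (fun i j _ => hcomm i j) fun i => Module.End.iSup_maxGenEigenspace_eq_top (f i)]
    refine iSup_le fun χ v hv => Submodule.subset_span fun i => ⟨χ i, ?_⟩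
    have h1 := (Submodule.mem_iInf _).mp hv i
    rw [(hss i).isFinitelySemisimple.maxGenEigenspace_eq_eigenspace] at h1
    exact Module.End.mem_eigenspace_iff.mp h1
  let b := Module.Basis.ofSpan hs
  have := FiniteDimensional.fintypeBasisIndex b
  have hcard := Module.finrank_eq_card_basis b
  refine ⟨b.reindex (Fintype.equivFinOfCardEq (hcard.symm.trans hd)), fun i k => ?_⟩
  have hmem : ∀ j, b j ∈ s := fun j => Module.Basis.ofSpan_subset hs ⟨j, rfl⟩
  simpa using hmem _ i

/-! ### Cartan subalgebras of sums of special linear Lie algebras -/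

section Cartan

variable {F 𝔤 ι : Type*} [Field F] [LieRing 𝔤] [LieAlgebra F 𝔤] {n : ι → ℕ}
  {θ : 𝔤 →ₗ[F] Π i, Matrix (Fin (n i)) (Fin (n i)) F}

/-- A centralizing element normalizes, and Cartan subalgebras are self-normalizing. -/
theorem LieSubalgebra.IsCartanSubalgebra.mem_of_forall_lie_eq_zero {𝔥 : LieSubalgebra F 𝔤}
    (h𝔥 : 𝔥.IsCartanSubalgebra) {x : 𝔤} (hx : ∀ h ∈ 𝔥, ⁅x, h⁆ = 0) : x ∈ 𝔥 := by
  rw [← h𝔥.self_normalizing, LieSubalgebra.mem_normalizer_iff]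
  intro y hy
  rw [hx y hy]
  exact zero_mem _

theorem IsSlCoordinates.finiteDimensional [Finite ι] (hθ : IsSlCoordinates θ) :
    FiniteDimensional F 𝔤 :=
  Module.Finite.of_injective θ hθ.injective

theorem IsSlCoordinates.isLieAbelian [Finite ι] [CharZero F] (hθ : IsSlCoordinates θ)
    {𝔥 : LieSubalgebra F 𝔤} (h𝔥 : 𝔥.IsCartanSubalgebra) : IsLieAbelian 𝔥 := by
  have := hθ.finiteDimensional
  have := hθ.hasTrivialRadical
  infer_instance

theorem IsSlCoordinates.commute [Finite ι] [CharZero F] (hθ : IsSlCoordinates θ)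
    {𝔥 : LieSubalgebra F 𝔤} (h𝔥 : 𝔥.IsCartanSubalgebra) {x y : 𝔤} (hx : x ∈ 𝔥) (hy : y ∈ 𝔥) (i : ι) :
    Commute (θ x i) (θ y i) := by
  have := hθ.isLieAbelian h𝔥
  have h0 : (⁅(⟨x, hx⟩ : 𝔥), (⟨y, hy⟩ : 𝔥)⁆ : 𝔥) = 0 := trivial_lie_zero _ _ _ _
  have h1 : ⁅x, y⁆ = 0 := congrArg Subtype.val h0
  have := hθ.map_lie x y i
  rw [h1] at this
  exact sub_eq_zero.mp (by simpa using this.symm)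

/-- In the coordinate `i`, `ad x` is the difference of left and right multiplication by `θ x i`,
which are commuting nilpotent maps. -/
theorem IsSlCoordinates.isNilpotent_ad (hθ : IsSlCoordinates θ) {i : ι} {x : 𝔤}
    (hx : x ∈ hθ.component i) (hnil : IsNilpotent (θ x i)) :
    IsNilpotent (LieAlgebra.ad F 𝔤 x) := by
  set D := LinearMap.mulLeft F (θ x i) - LinearMap.mulRight F (θ x i) with hD
  obtain ⟨k, hk⟩ : IsNilpotent D := (LinearMap.commute_mulLeft_right _ _).isNilpotent_sub
    (by rwa [LinearMap.isNilpotent_mulLeft_iff]) (by rwa [LinearMap.isNilpotent_mulRight_iff])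
  have h1 : ∀ (r : ℕ) (y : 𝔤), θ ((LieAlgebra.ad F 𝔤 x ^ r) y) i = (D ^ r) (θ y i) := by
    intro r y
    induction r with
    | zero => simp
    | succ r ih =>
      rw [pow_succ', pow_succ', Module.End.mul_apply, Module.End.mul_apply, ← ih]
      simp [hθ.map_lie, hD]
  -- The extra factor puts the result into the component, where vanishing of the coordinate `i` is
  -- enough.
  refine ⟨k + 1, ?_⟩
  ext y
  have hmem : (LieAlgebra.ad F 𝔤 x ^ (k + 1)) y ∈ hθ.component i := by
    rw [pow_succ', Module.End.mul_apply]
    exact lie_mem_left F 𝔤 (hθ.component i) x _ hx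
  refine hθ.ext_component hmem (zero_mem _) ?_
  rw [h1, pow_succ, hk]
  simp

/-- The elements of a Cartan subalgebra act semisimply on the natural modules. -/
theorem IsSlCoordinates.isSemisimple [Finite ι] [CharZero F] (hθ : IsSlCoordinates θ)
    {𝔥 : LieSubalgebra F 𝔤} (h𝔥 : 𝔥.IsCartanSubalgebra) {x : 𝔤} (hx : x ∈ 𝔥) (i : ι) :
    Module.End.IsSemisimple (Matrix.toLin' (θ x i)) := by
  have := hθ.finiteDimensional
  have := hθ.hasTrivialRadical
  -- Jordan decomposition: the nilpotent part `N` is a polynomial in the matrix of `x` and has trace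
  -- zero. It therefore lifts to some `y` centralizing `𝔥`, so `y ∈ 𝔥`; being ad-nilpotent, `y` is
  -- zero.
  obtain ⟨N, hN, s, -, hNnil, hs, hNs⟩ :=
    Module.End.exists_isNilpotent_isSemisimple (f := Matrix.toLin' (θ x i))
  have hNnil' : IsNilpotent (LinearMap.toMatrix' N) :=
    hNnil.map (LinearMap.toMatrixAlgEquiv' (R := F) (n := Fin (n i)))
  have htr : (LinearMap.toMatrix' N).trace = 0 :=
    (Matrix.isNilpotent_trace_of_isNilpotent hNnil').eq_zero
  obtain ⟨y, hy, hyi⟩ := hθ.exists_component htr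
  have hy𝔥 : y ∈ 𝔥 := by
    refine h𝔥.mem_of_forall_lie_eq_zero fun h hh => ?_
    refine hθ.ext_component (lie_mem_left F 𝔤 (hθ.component i) y h hy) (zero_mem _) ?_
    rw [hθ.map_lie, hyi]
    have hc : Commute (Matrix.toLin' (θ h i)) (Matrix.toLin' (θ x i)) :=
      (hθ.commute h𝔥 hh hx i).map (Matrix.toLinAlgEquiv' (R := F) (n := Fin (n i)))
    have hc2 : Commute (Matrix.toLin' (θ h i)) N :=
      Algebra.commute_of_mem_adjoin_singleton_of_commute hN hc
    have hc3 := hc2.map (LinearMap.toMatrixAlgEquiv' (R := F) (n := Fin (n i)))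
    have hc4 : θ h i * LinearMap.toMatrix' N = LinearMap.toMatrix' N * θ h i := by
      have h5 : LinearMap.toMatrixAlgEquiv' (Matrix.toLin' (θ h i)) = θ h i :=
        LinearMap.toMatrix'_toLin' _
      rw [h5] at hc3
      exact hc3.eq
    simp [hc4]
  have hy0 := LieAlgebra.IsKilling.eq_zero_of_isNilpotent_ad_of_mem_isCartanSubalgebra F 𝔤 𝔥 hy𝔥
    (hθ.isNilpotent_ad hy (hyi ▸ hNnil'))
  have hN0 : N = 0 := by
    rw [hy0] at hyi
    simpa using hyi.symm
  rw [hNs, hN0, zero_add]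
  exact hs

/-- The natural modules have bases of common eigenvectors of a Cartan subalgebra. -/
theorem IsSlCoordinates.exists_basis [Finite ι] [CharZero F] [IsAlgClosed F]
    (hθ : IsSlCoordinates θ) {𝔥 : LieSubalgebra F 𝔤} (h𝔥 : 𝔥.IsCartanSubalgebra) (i : ι) :
    ∃ b : Module.Basis (Fin (n i)) F (Fin (n i) → F), ∀ (h : 𝔥) k, ∃ c : F,
      (θ h i).mulVec (b k) = c • b k := by
  have := exists_basis_common_eigenvectors (fun h : 𝔥 => Matrix.toLin' (θ h i))
    (fun h h' => (hθ.commute h𝔥 h.2 h'.2 i).map (Matrix.toLinAlgEquiv' (R := F) (n := Fin (n i))))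
    (fun h => hθ.isSemisimple h𝔥 h.2 i) (d := n i) (by simp)
  simpa using this

/-- Off-diagonal matrix units have nonzero weight with respect to a diagonal Cartan subalgebra. -/
theorem IsSlCoordinates.exists_diag_ne (hθ : IsSlCoordinates θ)
    {𝔥 : LieSubalgebra F 𝔤} (h𝔥 : 𝔥.IsCartanSubalgebra)
    (hdiag : ∀ h ∈ 𝔥, ∀ i k l, k ≠ l → θ h i k l = 0) {i : ι} {k l : Fin (n i)} (hkl : k ≠ l) :
    ∃ h ∈ 𝔥, θ h i k k ≠ θ h i l l := by
  by_contra! hall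
  obtain ⟨x, hx, hxi⟩ := hθ.exists_component_single hkl
  -- If the two diagonal entries agreed on all of `𝔥`, the matrix unit would centralize `𝔥` and so
  -- lie in it, although `𝔥` is diagonal.
  have hx𝔥 : x ∈ 𝔥 := by
    refine h𝔥.mem_of_forall_lie_eq_zero fun h hh => ?_
    refine hθ.ext_component (lie_mem_left F 𝔤 (hθ.component i) x h hx) (zero_mem _) ?_
    rw [hθ.map_lie, hxi, comm_single_of_diagonal (hdiag h hh i), hall h hh]
    simp
  have := hdiag x hx𝔥 i k l hkl
  rw [hxi] at this
  simp at this

end Cartan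

/-! ### Integrality of eigenvalues -/

/-- The eigenvalues of `h` on a finite dimensional module over an `sl₂`-triple are integers. -/
theorem IsSl2Triple.exists_int_eq_of_eigenvector {F L M : Type*} [Field F] [CharZero F] [LieRing L]
    [LieAlgebra F L] [AddCommGroup M] [Module F M] [LieRingModule L M] [LieModule F L M]
    [FiniteDimensional F M] {h e f : L} (t : IsSl2Triple h e f) {v : M} (hv : v ≠ 0) {c : F}
    (hc : ⁅h, v⁆ = c • v) : ∃ z : ℤ, c = z := by
  let E := LieModule.toEnd F L M e
  have heig : ∀ k : ℕ, ⁅h, (E ^ k) v⁆ = (c + 2 * k) • (E ^ k) v := by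
    intro k
    induction k with
    | zero => simpa using hc
    | succ k ih =>
      rw [pow_succ', Module.End.mul_apply]
      change ⁅h, ⁅e, (E ^ k) v⁆⁆ = _ • ⁅e, (E ^ k) v⁆
      rw [leibniz_lie, ih, t.lie_h_e_smul F, smul_lie, lie_smul, ← add_smul]
      push_cast
      congr 1
      ring
  -- Otherwise `h` would have the infinitely many eigenvalues `c + 2k`.
  have hex : ∃ k : ℕ, (E ^ k) v = 0 := by
    by_contra! hne
    have hev : ∀ k : ℕ, (LieModule.toEnd F L M h).HasEigenvalue (c + 2 * k) := fun k =>
      Module.End.hasEigenvalue_of_hasEigenvector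
        ⟨Module.End.mem_eigenspace_iff.mpr (heig k), hne k⟩
    have hinj : Function.Injective fun k : ℕ =>
        (⟨c + 2 * k, hev k⟩ : (LieModule.toEnd F L M h).Eigenvalues) := by
      intro a b hab
      have : c + 2 * (a : F) = c + 2 * b := congrArg Subtype.val hab
      simpa using this
    have : Infinite (LieModule.toEnd F L M h).Eigenvalues := Infinite.of_injective _ hinj
    exact not_finite (LieModule.toEnd F L M h).Eigenvalues
  classical
  let k := Nat.find hex
  have hk : (E ^ k) v = 0 := Nat.find_spec hex
  have hk0 : k ≠ 0 := fun h0 => hv (by simpa [h0] using hk)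
  obtain ⟨r, hr⟩ := Nat.exists_eq_succ_of_ne_zero hk0
  have hr0 : (E ^ r) v ≠ 0 := Nat.find_min hex (show r < k by omega)
  -- The last nonzero vector of the string is primitive, so its eigenvalue `c + 2r` is a natural
  -- number.
  have P : t.HasPrimitiveVectorWith ((E ^ r) v) (c + 2 * (r : F)) :=
    ⟨hr0, heig r, by rw [hr, Nat.succ_eq_add_one, pow_succ', Module.End.mul_apply] at hk; exact hk⟩
  obtain ⟨N, hN⟩ := P.exists_nat
  exact ⟨N - 2 * r, by push_cast; rw [← hN]; ring⟩

/-! ### Semisimple algebras without assumed identity -/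

section Wedderburn

variable {F B : Type*} [Field F] [NonUnitalRing B] [Module F B] [IsScalarTower F B B]
  [SMulCommClass F B B]

instance Unitization.finiteDimensional [FiniteDimensional F B] :
    FiniteDimensional F (Unitization F B) :=
  Module.Finite.of_injective
    ((Unitization.fstHom F B).toLinearMap.prod (Unitization.sndHom F F B)) fun x y h => by
      ext
      · exact congrArg Prod.fst h
      · exact congrArg Prod.snd h

/-- Adjoining an identity to a semisimple algebra yields a semisimple ring. -/
theorem IsSemisimpleAlg.isSemisimpleRing_unitization [FiniteDimensional F B]
    (hB : IsSemisimpleAlg F B) : IsSemisimpleRing (Unitization F B) := by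
  have : IsArtinianRing (Unitization F B) := IsArtinianRing.of_finite F _
  rw [IsArtinianRing.isSemisimpleRing_iff_jacobson]
  set J := Ring.jacobson (Unitization F B) with hJ
  obtain ⟨m, hm⟩ : IsNilpotent J := IsSemiprimaryRing.isNilpotent
  let I : Submodule F B := (J.restrictScalars F).comap (Unitization.inrHom F F B)
  have hmemI : ∀ x : B, x ∈ I ↔ (x : Unitization F B) ∈ J := fun x => Iff.rfl
  have hI : IsAlgIdeal F I := by
    intro b x hx
    rw [hmemI] at hx
    refine ⟨?_, ?_⟩
    · rw [hmemI, Unitization.inr_mul]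
      exact J.mul_mem_left _ hx
    · rw [hmemI, Unitization.inr_mul]
      exact J.mul_mem_right _ hx
  -- The exponent is shifted because `idealPow` starts at `I` itself.
  have hpow : ∀ r x, x ∈ idealPow F I r → (x : Unitization F B) ∈ J ^ (r + 1) := by
    intro r
    induction r with
    | zero => intro x hx; rw [zero_add, Submodule.pow_one]; exact hx
    | succ r ih =>
      intro x hx
      have hle : idealPow F I (r + 1) ≤
          ((J ^ (r + 2)).restrictScalars F).comap (Unitization.inrHom F F B) := by
        rw [idealPow, Submodule.span_le]
        rintro _ ⟨y, hy, z, hz, rfl⟩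
        change ((y * z : B) : Unitization F B) ∈ J ^ (r + 2)
        rw [Unitization.inr_mul, Submodule.pow_succ]
        exact Ideal.mul_mem_mul (ih y hy) hz
      exact hle hx
  have hIbot : I = ⊥ := by
    refine hB I hI ⟨m, ?_⟩
    rw [eq_bot_iff]
    intro x hx
    have h1 := hpow m x hx
    rw [Submodule.pow_succ, hm] at h1
    have h2 : (x : Unitization F B) = 0 := by simpa using h1
    exact Unitization.inr_injective h2
  rw [eq_bot_iff]
  intro j hj
  -- The scalar part of a nilpotent element is nilpotent in a field, hence zero; so the radical lies
  -- inside `B`.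
  have hnil : IsNilpotent j := by
    refine ⟨m, ?_⟩
    have := Ideal.pow_mem_pow hj m
    rw [hm] at this
    simpa using this
  have hfst : j.fst = 0 := by
    have := hnil.map (Unitization.fstHom F B)
    exact this.eq_zero
  have hj' : j = (j.snd : Unitization F B) := by
    ext <;> simp [hfst]
  have : j.snd ∈ I := by rw [hmemI, ← hj']; exact hj
  rw [hIbot, Submodule.mem_bot] at this
  rw [hj', this]
  simp

/-- A finite dimensional semisimple algebra, possibly without identity, is a product of matrix
algebras. -/
theorem IsSemisimpleAlg.exists_bijective_pi_matrix [IsAlgClosed F] [FiniteDimensional F B]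
    (hB : IsSemisimpleAlg F B) : ∃ (ι : Type) (_ : Fintype ι) (n : ι → ℕ)
      (φ : B →ₙₐ[F] Π i, Matrix (Fin (n i)) (Fin (n i)) F),
      Function.Bijective φ ∧ ∀ i, n i ≠ 0 := by
  classical
  have := hB.isSemisimpleRing_unitization
  obtain ⟨k, d, hd, ⟨ψ⟩⟩ :=
    IsSemisimpleRing.exists_algEquiv_pi_matrix_of_isAlgClosed F (Unitization F B)
  let ε := Unitization.fstHom F B
  have hsum : ∑ i, ε (ψ.symm (Pi.single i 1)) = 1 := by
    rw [← map_sum, ← map_sum]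
    have : ∑ i, (Pi.single i 1 : Π i, Matrix (Fin (d i)) (Fin (d i)) F) = 1 :=
      Finset.univ_sum_single 1
    rw [this, map_one, map_one]
  obtain ⟨o, ho⟩ : ∃ o, ε (ψ.symm (Pi.single o 1)) ≠ 0 := by
    by_contra! h
    simp [h] at hsum
  have ho1 : ε (ψ.symm (Pi.single o 1)) = 1 := by
    have : ε (ψ.symm (Pi.single o 1)) * ε (ψ.symm (Pi.single o 1)) =
        ε (ψ.symm (Pi.single o 1)) := by
      rw [← map_mul, ← map_mul, ← Pi.single_mul, one_mul]
    exact mul_right_cancel₀ ho (by rw [this, one_mul])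
  -- `B` is the kernel of the augmentation `ε`. On the factor `o`, `ε` is a ring homomorphism from a
  -- simple ring to a field, hence injective; so `B` maps isomorphically onto the product of the
  -- remaining factors.
  let χ : Matrix (Fin (d o)) (Fin (d o)) F →+* F :=
    { toFun := fun M => ε (ψ.symm (Pi.single o M))
      map_one' := ho1
      map_mul' := fun M N => by rw [← map_mul, ← map_mul, ← Pi.single_mul]
      map_zero' := by rw [Pi.single_zero, map_zero, map_zero]
      map_add' := fun M N => by rw [← map_add, ← map_add, ← Pi.single_add] }
  have hdo := hd o
  have hχ : Function.Injective χ := RingHom.injective χ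
  let φ : B →ₙₐ[F] Π i : {i // i ≠ o}, Matrix (Fin (d i)) (Fin (d i)) F :=
    { toFun := fun b i => ψ (b : Unitization F B) i
      map_smul' := fun c b => by funext i; simp
      map_zero' := by funext i; simp
      map_add' := fun a b => by funext i; simp
      map_mul' := fun a b => by funext i; simp }
  refine ⟨{i // i ≠ o}, inferInstance, fun i => d i, φ, ⟨?_, ?_⟩, fun i => (hd i).ne⟩
  · rw [injective_iff_map_eq_zero]
    intro b hb
    have h1 : ψ (b : Unitization F B) = Pi.single o (ψ (b : Unitization F B) o) := by
      funext i
      by_cases hi : i = o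
      · subst hi; simp
      · rw [Pi.single_eq_of_ne hi]
        exact congrFun hb ⟨i, hi⟩
    have h2 : χ (ψ (b : Unitization F B) o) = 0 := by
      change ε (ψ.symm (Pi.single o _)) = 0
      rw [← h1, AlgEquiv.symm_apply_apply]
      exact Unitization.fst_inr F b
    have h3 := hχ (h2.trans (map_zero χ).symm)
    rw [h3, Pi.single_zero] at h1
    have h4 : (b : Unitization F B) = 0 := by simpa using h1
    exact Unitization.inr_injective h4
  · intro M
    let u := ψ.symm fun i => if h : i ≠ o then M ⟨i, h⟩ else 0
    -- `u` annihilates the identity of the factor `o`, on which `ε` takes the value one.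
    have hu : ε u = 0 := by
      have h1 : u * ψ.symm (Pi.single o 1) = 0 := by
        rw [← map_mul]
        convert map_zero ψ.symm
        funext i
        by_cases hi : i = o
        · subst hi; simp
        · simp [Pi.single_eq_of_ne hi]
      have h2 := congrArg ε h1
      rwa [map_mul, ho1, mul_one, map_zero] at h2
    refine ⟨u.snd, ?_⟩
    have h3 : ((u.snd : B) : Unitization F B) = u := by
      ext
      · exact hu.symm
      · rfl
    funext i
    change ψ ((u.snd : B) : Unitization F B) i = _
    rw [h3]
    simp [u, i.2]

end Wedderburn

/-- An algebra without ideals of codimension one has no one-dimensional matrix quotients. -/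
theorem IsKPerfect.two_le {F B : Type*} [Field F] [NonUnitalRing B] [Module F B]
    (hB : IsKPerfect F B 1) {n : ℕ} (hn : n ≠ 0)
    (ρ : B →ₙₐ[F] Matrix (Fin n) (Fin n) F) (hρ : Function.Surjective ρ) : 2 ≤ n := by
  by_contra hlt
  obtain rfl : n = 1 := by omega
  let l : B →ₗ[F] Matrix (Fin 1) (Fin 1) F := ρ
  have hl : Function.Surjective l := hρ
  refine hB (LinearMap.ker l) (fun b x hx => ?_) (fun h => ?_) ?_
  · have hx' : ρ x = 0 := hx
    constructor
    · change ρ (b * x) = 0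
      rw [map_mul, hx', mul_zero]
    · change ρ (x * b) = 0
      rw [map_mul, hx', zero_mul]
  · obtain ⟨x, hx⟩ := hl 1
    have : x ∈ LinearMap.ker l := h ▸ Submodule.mem_top
    rw [LinearMap.mem_ker, hx] at this
    exact one_ne_zero this
  · let e := l.quotKerEquivOfSurjective hl
    have : Module.Finite F (B ⧸ LinearMap.ker l) := Module.Finite.equiv e.symm
    rw [← Module.finrank_eq_rank, e.finrank_eq]
    simp [Module.finrank_matrix]

/-! ### Peirce decomposition with respect to weighted idempotents -/

section Peirce

variable {F A H P : Type*} [Field F] [NonUnitalRing A] [Module F A] [IsScalarTower F A A]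
  [SMulCommClass F A A] [AddCommGroup H] [Module F H]

/-- The space of `x` with `a h * x - x * a h = γ h • x` for all `h`. -/
def commWeightSpace (a : H → A) (γ : Module.Dual F H) : Submodule F A where
  carrier := {x | ∀ h, a h * x - x * a h = γ h • x}
  zero_mem' := fun h => by simp
  add_mem' := fun {x y} hx hy h => by
    rw [smul_add, ← hx h, ← hy h, mul_add, add_mul]; abel
  smul_mem' := fun c x hx h => by
    rw [mul_smul_comm, smul_mul_assoc, ← smul_sub, hx h, smul_comm]

/-- Commutation with `a h` is a derivation, so weights add. -/
theorem mul_mem_commWeightSpace {a : H → A} {α β : Module.Dual F H} {x y : A}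
    (hx : x ∈ commWeightSpace a α) (hy : y ∈ commWeightSpace a β) :
    x * y ∈ commWeightSpace a (α + β) := fun h =>
  calc a h * (x * y) - x * y * a h = (a h * x - x * a h) * y + x * (a h * y - y * a h) := by
        noncomm_ring
    _ = (α + β) h • (x * y) := by
        rw [hx h, hy h, smul_mul_assoc, mul_smul_comm, ← add_smul]; rfl

theorem comm_mem_commWeightSpace {a : H → A} {α β : Module.Dual F H} {x y : A}
    (hx : x ∈ commWeightSpace a α) (hy : y ∈ commWeightSpace a β) :
    x * y - y * x ∈ commWeightSpace a (α + β) :=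
  sub_mem (mul_mem_commWeightSpace hx hy) (add_comm α β ▸ mul_mem_commWeightSpace hy hx)

/-- The elements `e p` are idempotents on which the elements `a h` act, from both sides, with the
weight `wt p`, and `∑ p, e p` is a two-sided identity for the `a h`. -/
structure IsWeightedIdempotents [Fintype P] (a : H → A) (e : P → A)
    (wt : P → Module.Dual F H) : Prop where
  idem : ∀ p, e p * e p = e p
  mul_idem : ∀ h p, a h * e p = wt p h • e p
  idem_mul : ∀ h p, e p * a h = wt p h • e p
  mul_sum : ∀ h, a h * ∑ p, e p = a h
  sum_mul : ∀ h, (∑ p, e p) * a h = a h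

/-- The weight of a Peirce index; `none` is the index of the complement of `∑ p, e p`. -/
def peirceWeight (wt : P → Module.Dual F H) : Option P → Module.Dual F H
  | none => 0
  | some p => wt p

variable [Fintype P]

variable (F) in
/-- The left Peirce projections. -/
def peirceLeft (e : P → A) : Option P → A →ₗ[F] A
  | none => LinearMap.id - LinearMap.mulLeft F (∑ p, e p)
  | some p => LinearMap.mulLeft F (e p)

variable (F) in
/-- The right Peirce projections. -/
def peirceRight (e : P → A) : Option P → A →ₗ[F] A
  | none => LinearMap.id - LinearMap.mulRight F (∑ p, e p)
  | some p => LinearMap.mulRight F (e p)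

variable (F) in
/-- The projections onto the Peirce components. -/
def peirceProj (e : P → A) (i j : Option P) : A →ₗ[F] A := peirceLeft F e i ∘ₗ peirceRight F e j

theorem peirceProj_apply (e : P → A) (i j : Option P) (x : A) :
    peirceProj F e i j x = peirceLeft F e i (peirceRight F e j x) := rfl

theorem peirceLeft_mul (e : P → A) (i : Option P) (x y : A) :
    peirceLeft F e i (x * y) = peirceLeft F e i x * y := by
  cases i <;> simp [peirceLeft, sub_mul, mul_assoc]

theorem peirceRight_mul (e : P → A) (i : Option P) (x y : A) :
    peirceRight F e i (x * y) = x * peirceRight F e i y := by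
  cases i <;> simp [peirceRight, mul_sub, mul_assoc]

theorem peirceProj_eq_right_left (e : P → A) (i j : Option P) (x : A) :
    peirceProj F e i j x = peirceRight F e j (peirceLeft F e i x) := by
  rw [peirceProj_apply]
  cases i <;> cases j <;>
    simp [peirceRight, peirceLeft, mul_sub, sub_mul, mul_assoc]
  abel

theorem sum_peirceLeft (e : P → A) (x : A) : ∑ i, peirceLeft F e i x = x := by
  rw [Fintype.sum_option]
  simp [peirceLeft, Finset.sum_mul]

theorem sum_peirceRight (e : P → A) (x : A) : ∑ i, peirceRight F e i x = x := by
  rw [Fintype.sum_option]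
  simp [peirceRight, Finset.mul_sum]

theorem sum_peirceProj (e : P → A) (x : A) : ∑ i, ∑ j, peirceProj F e i j x = x := by
  simp_rw [peirceProj_apply, ← map_sum, sum_peirceRight, sum_peirceLeft]

namespace IsWeightedIdempotents

variable {a : H → A} {e : P → A} {wt : P → Module.Dual F H}

/-- At `none` the product vanishes because `∑ p, e p` is an identity for `a h`; this is why `none`
gets weight zero. -/
theorem mul_peirceLeft (he : IsWeightedIdempotents a e wt) (h : H) (i : Option P) (x : A) :
    a h * peirceLeft F e i x = peirceWeight wt i h • peirceLeft F e i x := by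
  cases i
  · simp [peirceLeft, peirceWeight, mul_sub, ← mul_assoc, he.mul_sum]
  · simp [peirceLeft, peirceWeight, ← mul_assoc, he.mul_idem, smul_mul_assoc]

theorem peirceLeft_mul_eq (he : IsWeightedIdempotents a e wt) (h : H) (i : Option P) (x : A) :
    peirceLeft F e i (a h * x) = peirceWeight wt i h • peirceLeft F e i x := by
  cases i
  · simp [peirceLeft, peirceWeight, ← mul_assoc, he.sum_mul]
  · simp [peirceLeft, peirceWeight, ← mul_assoc, he.idem_mul, smul_mul_assoc]

theorem peirceRight_mul_comm (he : IsWeightedIdempotents a e wt) (h : H) (i : Option P) (x : A) :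
    peirceRight F e i x * a h = peirceWeight wt i h • peirceRight F e i x := by
  cases i
  · simp [peirceRight, peirceWeight, sub_mul, mul_assoc, he.sum_mul]
  · simp [peirceRight, peirceWeight, mul_assoc, he.idem_mul, mul_smul_comm]

theorem peirceRight_mul_eq (he : IsWeightedIdempotents a e wt) (h : H) (i : Option P) (x : A) :
    peirceRight F e i (x * a h) = peirceWeight wt i h • peirceRight F e i x := by
  cases i
  · simp [peirceRight, peirceWeight, mul_assoc, he.mul_sum]
  · simp [peirceRight, peirceWeight, mul_assoc, he.mul_idem, mul_smul_comm]

theorem peirceProj_mem (he : IsWeightedIdempotents a e wt) (i j : Option P) (x : A) :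
    peirceProj F e i j x ∈ commWeightSpace a (peirceWeight wt i - peirceWeight wt j) := by
  intro h
  rw [peirceProj_apply, he.mul_peirceLeft, ← peirceProj_apply, peirceProj_eq_right_left,
    he.peirceRight_mul_comm, ← sub_smul]
  rfl

theorem peirceProj_comm (he : IsWeightedIdempotents a e wt) (i j : Option P) (h : H) (x : A) :
    peirceProj F e i j (a h * x - x * a h) =
      (peirceWeight wt i - peirceWeight wt j) h • peirceProj F e i j x := by
  rw [map_sub, peirceProj_eq_right_left, he.peirceLeft_mul_eq, map_smul,
    ← peirceProj_eq_right_left, peirceProj_apply e i j (x * a h), he.peirceRight_mul_eq, map_smul,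
    ← peirceProj_apply, ← sub_smul]
  rfl

/-- Projecting `[a h, x]` multiplies the projection of `x` by `γ h` and also by the difference of
the Peirce weights. Orthogonality of the `e p` plays no role here. -/
theorem eq_of_peirceProj_ne_zero (he : IsWeightedIdempotents a e wt) {γ : Module.Dual F H} {x : A}
    (hx : x ∈ commWeightSpace a γ) {i j : Option P} (hij : peirceProj F e i j x ≠ 0) :
    γ = peirceWeight wt i - peirceWeight wt j := by
  ext h
  have h1 := he.peirceProj_comm i j h x
  rw [hx h, map_smul] at h1
  exact smul_left_injective F hij h1

theorem exists_of_ne_zero (he : IsWeightedIdempotents a e wt) {γ : Module.Dual F H} {x : A}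
    (hx : x ∈ commWeightSpace a γ) (hx0 : x ≠ 0) :
    ∃ i j, γ = peirceWeight wt i - peirceWeight wt j ∧ peirceProj F e i j x ≠ 0 := by
  by_contra! h
  apply hx0
  rw [← sum_peirceProj (F := F) e x]
  refine Finset.sum_eq_zero fun i _ => Finset.sum_eq_zero fun j _ => ?_
  by_contra hne
  exact hne (h i j (he.eq_of_peirceProj_ne_zero hx hne))

end IsWeightedIdempotents

open Classical in
/-- The projection onto the zero weight space. -/
noncomputable def zeroProj (e : P → A) (wt : P → Module.Dual F H) : A →ₗ[F] A :=
  ∑ i, ∑ j, if peirceWeight wt i = peirceWeight wt j then peirceProj F e i j else 0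

namespace IsWeightedIdempotents

variable {a : H → A} {e : P → A} {wt : P → Module.Dual F H}

open Classical in
theorem zeroProj_apply (x : A) : zeroProj e wt x =
    ∑ i, ∑ j, if peirceWeight wt i = peirceWeight wt j then peirceProj F e i j x else 0 := by
  simp only [zeroProj, LinearMap.sum_apply]
  refine Finset.sum_congr rfl fun i _ => Finset.sum_congr rfl fun j _ => ?_
  split_ifs <;> rfl

open Classical in
theorem sub_zeroProj (x : A) : x - zeroProj e wt x =
    ∑ i, ∑ j, if peirceWeight wt i = peirceWeight wt j then 0 else peirceProj F e i j x := by
  conv_lhs => enter [1]; rw [← sum_peirceProj (F := F) e x]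
  rw [zeroProj_apply, ← Finset.sum_sub_distrib]
  refine Finset.sum_congr rfl fun i _ => ?_
  rw [← Finset.sum_sub_distrib]
  refine Finset.sum_congr rfl fun j _ => ?_
  split_ifs <;> simp

theorem zeroProj_mem (he : IsWeightedIdempotents a e wt) (x : A) :
    zeroProj e wt x ∈ commWeightSpace a (0 : Module.Dual F H) := by
  rw [zeroProj_apply]
  refine Submodule.sum_mem _ fun i _ => Submodule.sum_mem _ fun j _ => ?_
  split_ifs with h
  · simpa [h] using he.peirceProj_mem i j x
  · exact zero_mem _

theorem zeroProj_eq_self (he : IsWeightedIdempotents a e wt) {x : A}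
    (hx : x ∈ commWeightSpace a (0 : Module.Dual F H)) : zeroProj e wt x = x := by
  rw [eq_comm, ← sub_eq_zero, sub_zeroProj]
  refine Finset.sum_eq_zero fun i _ => Finset.sum_eq_zero fun j _ => ?_
  split_ifs with h
  · rfl
  · by_contra hne
    exact h (sub_eq_zero.mp (he.eq_of_peirceProj_ne_zero hx hne).symm)

theorem zeroProj_eq_zero (he : IsWeightedIdempotents a e wt) {γ : Module.Dual F H} (hγ : γ ≠ 0)
    {x : A} (hx : x ∈ commWeightSpace a γ) : zeroProj e wt x = 0 := by
  rw [zeroProj_apply]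
  refine Finset.sum_eq_zero fun i _ => Finset.sum_eq_zero fun j _ => ?_
  split_ifs with h
  · by_contra hne
    exact hγ (by rw [he.eq_of_peirceProj_ne_zero hx hne, h, sub_self])
  · rfl

variable (F) in
/-- The span of the commutators of elements of opposite nonzero weights. -/
def oppositeCommutators (a : H → A) : Submodule F A :=
  Submodule.span F {z | ∃ α : Module.Dual F H, α ≠ 0 ∧ ∃ x ∈ commWeightSpace a α,
    ∃ y ∈ commWeightSpace a (-α), x * y - y * x = z}

theorem mem_oppositeCommutators {α : Module.Dual F H} (hα : α ≠ 0) {x y : A}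
    (hx : x ∈ commWeightSpace a α) (hy : y ∈ commWeightSpace a (-α)) :
    x * y - y * x ∈ oppositeCommutators F a :=
  Submodule.subset_span ⟨α, hα, x, hx, y, hy, rfl⟩

/-- If the idempotents of weight different from any given one generate `A`, then the zero weight
space is spanned by products of elements of opposite nonzero weights. -/
theorem mem_span_mul_of_mem_zero (he : IsWeightedIdempotents a e wt)
    (hgen : ∀ (γ : Module.Dual F H) (x : A),
      x ∈ Submodule.span F {z | ∃ p, wt p ≠ γ ∧ ∃ b c : A, b * e p * c = z})
    {x : A} (hx : x ∈ commWeightSpace a (0 : Module.Dual F H)) :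
    x ∈ Submodule.span F {z | ∃ α : Module.Dual F H, α ≠ 0 ∧ ∃ y ∈ commWeightSpace a α,
      ∃ y' ∈ commWeightSpace a (-α), y * y' = z} := by
  set N := Submodule.span F {z | ∃ α : Module.Dual F H, α ≠ 0 ∧ ∃ y ∈ commWeightSpace a α,
      ∃ y' ∈ commWeightSpace a (-α), y * y' = z} with hN
  rw [← he.zeroProj_eq_self hx, zeroProj_apply]
  refine Submodule.sum_mem _ fun i _ => Submodule.sum_mem _ fun j _ => ?_
  split_ifs with hij
  swap
  · exact zero_mem _
  -- With `e p` inserted twice, the `(i, j)` piece of `b * e p * c` factors through the pieces `(i,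
  -- p)` and `(p, j)`. As `i` and `j` have equal weights, these have opposite weights, nonzero by
  -- the choice of `p`.
  have hle : Submodule.span F {z | ∃ p, wt p ≠ peirceWeight wt i ∧ ∃ b c : A, b * e p * c = z} ≤
      N.comap (peirceProj F e i j) := by
    rw [Submodule.span_le]
    rintro _ ⟨p, hp, b, c, rfl⟩
    have h1 : peirceProj F e i j (b * e p * c) =
        peirceProj F e i (some p) b * peirceProj F e (some p) j c := by
      have h2 : b * e p * c = (b * e p) * (e p * c) := by
        rw [mul_assoc, mul_assoc, ← mul_assoc (e p), he.idem]
      rw [h2, peirceProj_apply, peirceRight_mul, peirceLeft_mul, peirceProj_apply,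
        peirceProj_eq_right_left]
      rfl
    change peirceProj F e i j (b * e p * c) ∈ N
    rw [h1]
    refine Submodule.subset_span ⟨peirceWeight wt i - wt p, sub_ne_zero.mpr hp.symm, _,
      he.peirceProj_mem i (some p) b, _, ?_, rfl⟩
    rw [neg_sub, hij]
    exact he.peirceProj_mem (some p) j c
  exact hle (hgen _ x)

/-- Write `x` as a sum of products `b * c` of opposite nonzero weights and use `[bc, y] = [b, cy] -
[yb, c]`. Multiplication by `y`, of weight zero, preserves the weights of `b` and `c`. -/
theorem comm_mem_oppositeCommutators (he : IsWeightedIdempotents a e wt)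
    (hgen : ∀ (γ : Module.Dual F H) (x : A),
      x ∈ Submodule.span F {z | ∃ p, wt p ≠ γ ∧ ∃ b c : A, b * e p * c = z})
    {x y : A} (hx : x ∈ commWeightSpace a (0 : Module.Dual F H))
    (hy : y ∈ commWeightSpace a (0 : Module.Dual F H)) :
    x * y - y * x ∈ oppositeCommutators F a := by
  have hle : Submodule.span F {z | ∃ α : Module.Dual F H, α ≠ 0 ∧ ∃ y ∈ commWeightSpace a α,
      ∃ y' ∈ commWeightSpace a (-α), y * y' = z} ≤
      (oppositeCommutators F a).comap (LinearMap.mulRight F y - LinearMap.mulLeft F y) := by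
    rw [Submodule.span_le]
    rintro _ ⟨α, hα, b, hb, c, hc, rfl⟩
    change b * c * y - y * (b * c) ∈ oppositeCommutators F a
    have h1 : b * c * y - y * (b * c) =
        (b * (c * y) - (c * y) * b) - ((y * b) * c - c * (y * b)) := by noncomm_ring
    rw [h1]
    refine sub_mem (mem_oppositeCommutators hα hb ?_) (mem_oppositeCommutators hα ?_ hc)
    · simpa using mul_mem_commWeightSpace hc hy
    · simpa using mul_mem_commWeightSpace hy hb
  exact hle (he.mem_span_mul_of_mem_zero hgen hx)

/-- By bilinearity `x` and `y` may be taken homogeneous. The projection then kills their commutator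
unless the weights are opposite; if both are zero, `comm_mem_oppositeCommutators` applies. -/
theorem zeroProj_comm_mem (he : IsWeightedIdempotents a e wt)
    (hgen : ∀ (γ : Module.Dual F H) (x : A),
      x ∈ Submodule.span F {z | ∃ p, wt p ≠ γ ∧ ∃ b c : A, b * e p * c = z}) (x y : A) :
    zeroProj e wt (x * y - y * x) ∈ oppositeCommutators F a := by
  have hom : ∀ {α β : Module.Dual F H} {x y : A}, x ∈ commWeightSpace a α →
      y ∈ commWeightSpace a β → zeroProj e wt (x * y - y * x) ∈ oppositeCommutators F a := by
    intro α β x y hx hy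
    have hmem := comm_mem_commWeightSpace hx hy
    by_cases hαβ : α + β = 0
    · rw [hαβ] at hmem
      rw [he.zeroProj_eq_self hmem]
      by_cases hα : α = 0
      · subst hα
        rw [zero_add] at hαβ
        subst hαβ
        exact he.comm_mem_oppositeCommutators hgen hx hy
      · rw [← neg_eq_of_add_eq_zero_right hαβ] at hy
        exact mem_oppositeCommutators hα hx hy
    · rw [he.zeroProj_eq_zero hαβ hmem]
      exact zero_mem _
  have hom_right : ∀ {β : Module.Dual F H} {y : A}, y ∈ commWeightSpace a β → ∀ x : A,
      zeroProj e wt (x * y - y * x) ∈ oppositeCommutators F a := by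
    intro β y hy x
    have : x ∈ (oppositeCommutators F a).comap
        (zeroProj e wt ∘ₗ (LinearMap.mulRight F y - LinearMap.mulLeft F y)) := by
      rw [← sum_peirceProj (F := F) e x]
      exact Submodule.sum_mem _ fun i _ => Submodule.sum_mem _ fun j _ =>
        hom (he.peirceProj_mem i j x) hy
    exact this
  have : y ∈ (oppositeCommutators F a).comap
      (zeroProj e wt ∘ₗ (LinearMap.mulLeft F x - LinearMap.mulRight F x)) := by
    rw [← sum_peirceProj (F := F) e y]
    exact Submodule.sum_mem _ fun i _ => Submodule.sum_mem _ fun j _ =>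
      hom_right (he.peirceProj_mem i j y) x
  exact this

end IsWeightedIdempotents

end Peirce

/-! ### Weight decompositions of Lie modules inside an associative algebra -/

section WeightModule

/-- The weight spaces of a module over a nilpotent Lie algebra are independent. -/
theorem iSupIndep_eigSpace {F H M : Type*} [Field F] [LieRing H] [LieAlgebra F H]
    [LieRing.IsNilpotent H] [AddCommGroup M] [Module F M] [LieRingModule H M] [LieModule F H M] :
    iSupIndep fun α : Module.Dual F H => eigSpace M α := by
  have h1 := LieModule.iSupIndep_genWeightSpace F H M
  rw [← LieSubmodule.iSupIndep_toSubmodule] at h1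
  have h2 := h1.comp (f := fun α : Module.Dual F H => (α : H → F)) DFunLike.coe_injective
  refine h2.mono fun α x hx => ?_
  have : x ∈ LieModule.weightSpace M (α : H → F) := (LieModule.mem_weightSpace _ _).mpr hx
  exact LieModule.weightSpace_le_genWeightSpace M _ this

theorem iSup_eigSpace_subtype_eq_top {F H M : Type*} [Field F] [LieRing H] [LieAlgebra F H]
    [AddCommGroup M] [Module F M] [LieRingModule H M] [LieModule F H M]
    (htop : ⨆ α : Module.Dual F H, eigSpace M α = ⊤) {Γ : Set (Module.Dual F H)}
    (hΓ : ∀ α, eigSpace M α ≠ ⊥ → α ∈ Γ) : ⨆ α : Γ, eigSpace M α.1 = ⊤ := by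
  rw [eq_top_iff, ← htop]
  refine iSup_le fun α => ?_
  by_cases h : eigSpace M α = ⊥
  · rw [h]; exact bot_le
  · exact le_iSup (fun α : Γ => eigSpace M α.1) ⟨α, hΓ α h⟩

variable {F A H P M : Type*} [Field F] [NonUnitalRing A] [Module F A] [IsScalarTower F A A]
  [SMulCommClass F A A] [LieRing H] [LieAlgebra F H] [AddCommGroup M] [Module F M]
  [LieRingModule H M] [LieModule F H M] {a : H → A} {j : M →ₗ[F] A}

/-- Carries the Peirce calculus in `A` over to modules embedded in `A`, in particular to `S⁽¹⁾` and
`A⁽¹⁾`. -/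
theorem mem_eigSpace_iff_mem_commWeightSpace (hj : Function.Injective j)
    (hja : ∀ h x, j ⁅h, x⁆ = a h * j x - j x * a h) {γ : Module.Dual F H} {x : M} :
    x ∈ eigSpace M γ ↔ j x ∈ commWeightSpace a γ := by
  refine forall_congr' fun h => ?_
  rw [← hja, ← map_smul]
  exact hj.eq_iff.symm

variable [Fintype P] {e : P → A} {wt : P → Module.Dual F H}

/-- A submodule of `A` containing the commutators of the `a h` with a subspace `T ⊇ M` stable under
the Peirce projections is the sum of its weight spaces. -/
theorem IsWeightedIdempotents.iSup_eigSpace_eq_top (he : IsWeightedIdempotents a e wt)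
    (hj : Function.Injective j) (hja : ∀ h x, j ⁅h, x⁆ = a h * j x - j x * a h)
    (T : Submodule F A) (hT : ∀ i k, ∀ x ∈ T, peirceProj F e i k x ∈ T) (hMT : ∀ x, j x ∈ T)
    (hTM : ∀ h, ∀ x ∈ T, ∃ y, j y = a h * x - x * a h) :
    ⨆ α : Module.Dual F H, eigSpace M α = ⊤ := by
  classical
  rw [eq_top_iff]
  intro x _
  -- A piece of nonzero weight is a multiple of its own commutator with some `a h`, so it comes from
  -- `M`.
  have hne : ∀ i k, peirceWeight wt i ≠ peirceWeight wt k →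
      ∃ y, j y = peirceProj F e i k (j x) := by
    intro i k hik
    obtain ⟨h, hh⟩ : ∃ h, (peirceWeight wt i - peirceWeight wt k) h ≠ 0 := by
      by_contra! h0
      exact hik (sub_eq_zero.mp (LinearMap.ext h0))
    obtain ⟨y, hy⟩ := hTM h _ (hT i k _ (hMT x))
    rw [he.peirceProj_mem i k (j x) h] at hy
    exact ⟨((peirceWeight wt i - peirceWeight wt k) h)⁻¹ • y, by
      rw [map_smul, hy, inv_smul_smul₀ hh]⟩
  have hex : ∀ i k, ∃ y, y ∈ (⨆ α : Module.Dual F H, eigSpace M α) ∧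
      j y = if peirceWeight wt i = peirceWeight wt k then 0 else peirceProj F e i k (j x) := by
    intro i k
    split_ifs with hik
    · exact ⟨0, zero_mem _, map_zero j⟩
    · obtain ⟨y, hy⟩ := hne i k hik
      refine ⟨y, ?_, hy⟩
      refine Submodule.mem_iSup_of_mem (peirceWeight wt i - peirceWeight wt k) ?_
      rw [mem_eigSpace_iff_mem_commWeightSpace hj hja, hy]
      exact he.peirceProj_mem i k _
  choose y hy hjy using hex
  have hsum : j (∑ i, ∑ k, y i k) = j x - zeroProj e wt (j x) := by
    rw [sub_zeroProj]
    simp only [map_sum, hjy]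
  -- The zero-weight pieces need not come from `M` one by one; only their sum does, as a difference
  -- of elements of `M`.
  have hx : x = (∑ i, ∑ k, y i k) + (x - ∑ i, ∑ k, y i k) := by abel
  rw [hx]
  refine add_mem (Submodule.sum_mem _ fun i _ => Submodule.sum_mem _ fun k _ => hy i k)
    (Submodule.mem_iSup_of_mem 0 ?_)
  rw [mem_eigSpace_iff_mem_commWeightSpace hj hja, map_sub, hsum, sub_sub_cancel]
  exact he.zeroProj_mem _

end WeightModule

/-! ### Integrality for `sl₂`-triples of endomorphisms and matrices -/

section MatrixTriple

attribute [local instance 101] LieRing.ofAssociativeRing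

/-- `IsSl2Triple` demands `h ≠ 0`, but a triple of `S⁽¹⁾` may act as zero in a representation. Hence
bare commutator relations are assumed and `h = 0` is treated apart. -/
theorem exists_int_eq_of_end_triple {F V : Type*} [Field F] [CharZero F] [AddCommGroup V]
    [Module F V] [FiniteDimensional F V] {h e f : Module.End F V} (hef : e * f - f * e = h)
    (hhe : h * e - e * h = 2 • e) (hhf : h * f - f * h = -(2 • f)) {v : V} (hv : v ≠ 0) {c : F}
    (hc : h v = c • v) : ∃ z : ℤ, c = z := by
  by_cases h0 : h = 0
  · refine ⟨0, ?_⟩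
    rw [h0, LinearMap.zero_apply, eq_comm, smul_eq_zero_iff_left hv] at hc
    simpa using hc
  · have t : IsSl2Triple h e f := ⟨h0, hef, hhe, hhf⟩
    exact t.exists_int_eq_of_eigenvector (F := F) hv hc

end MatrixTriple

theorem exists_int_eq_of_matrix_triple {F : Type*} [Field F] [CharZero F] {n : ℕ}
    {h e f : Matrix (Fin n) (Fin n) F} (hef : e * f - f * e = h)
    (hhe : h * e - e * h = 2 • e) (hhf : h * f - f * h = -(2 • f)) {v : Fin n → F} (hv : v ≠ 0)
    {c : F} (hc : h.mulVec v = c • v) : ∃ z : ℤ, c = z := by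
  let T := Matrix.toLinAlgEquiv' (R := F) (n := Fin n)
  refine exists_int_eq_of_end_triple (h := T h) (e := T e) (f := T f) ?_ ?_ ?_ hv hc
  · rw [← hef, map_sub, map_mul, map_mul]
  · rw [← map_mul, ← map_mul, ← map_sub, hhe, map_nsmul]
  · rw [← map_mul, ← map_mul, ← map_sub, hhf, map_neg, map_nsmul]

/-! ### `S⁽¹⁾` in matrix coordinates -/

section Coordinates

variable {F A : Type*} [Field F] [NonUnitalRing A] [Module F A]
  [IsScalarTower F A A] [SMulCommClass F A A] {S : NonUnitalSubalgebra F A}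

theorem subCommutatorToS_lie (x y : subCommutator S) :
    subCommutatorToS S ⁅x, y⁆ =
      subCommutatorToS S x * subCommutatorToS S y - subCommutatorToS S y * subCommutatorToS S x :=
  Subtype.ext rfl

/-- The inclusion of `S⁽¹⁾` in `S` as a linear map. -/
def subCommutatorToSLinear (S : NonUnitalSubalgebra F A) : subCommutator S →ₗ[F] S where
  toFun := subCommutatorToS S
  map_add' _ _ := Subtype.ext rfl
  map_smul' _ _ := Subtype.ext rfl

theorem mem_algCommutator (x y : A) : x * y - y * x ∈ algCommutator F A :=
  Submodule.subset_span ⟨x, trivial, y, trivial, rfl⟩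

/-- The commutator of two elements of `S`, as an element of `S⁽¹⁾`. -/
theorem exists_subCommutatorToS_eq_comm (x y : S) :
    ∃ z : subCommutator S, subCommutatorToS S z = x * y - y * x := by
  refine ⟨⟨⟨(x : A) * y - y * x, mem_algCommutator _ _⟩, ?_⟩, Subtype.ext rfl⟩
  exact Submodule.subset_span ⟨x, x.2, y, y.2, rfl⟩

variable {ι : Type} {n : ι → ℕ}

/-- The matrix coordinates of the elements of `S⁽¹⁾`. -/
def subCommutatorCoords (φ : S →ₙₐ[F] Π i, Matrix (Fin (n i)) (Fin (n i)) F) :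
    subCommutator S →ₗ[F] Π i, Matrix (Fin (n i)) (Fin (n i)) F :=
  (φ : S →ₗ[F] Π i, Matrix (Fin (n i)) (Fin (n i)) F) ∘ₗ subCommutatorToSLinear S

theorem subCommutatorCoords_apply (φ : S →ₙₐ[F] Π i, Matrix (Fin (n i)) (Fin (n i)) F)
    (x : subCommutator S) : subCommutatorCoords φ x = φ (subCommutatorToS S x) := rfl

theorem subCommutatorToS_injective : Function.Injective (subCommutatorToS S) := by
  intro x y h
  have : ((x : algCommutator F A) : A) = ((y : algCommutator F A) : A) :=
    congrArg (fun s : S => (s : A)) h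
  exact Subtype.ext (Subtype.ext this)

-- Commutators have trace zero. Conversely, within each factor, `E_kl = [E_kk, E_kl]` and `E_kk -
-- E_ll = [E_kl, E_lk]` for `k ≠ l`, so commutators span the traceless matrices.
open Matrix in
theorem isSlCoordinates_subCommutatorCoords [Finite ι]
    {φ : S →ₙₐ[F] Π i, Matrix (Fin (n i)) (Fin (n i)) F} (hφ : Function.Bijective φ) :
    IsSlCoordinates (subCommutatorCoords φ) where
  map_lie x y i := by
    rw [subCommutatorCoords_apply, subCommutatorToS_lie, map_sub, map_mul, map_mul]
    rfl
  injective := hφ.1.comp subCommutatorToS_injective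
  trace_eq_zero x i := by
    let T : Submodule F S :=
      LinearMap.ker (Matrix.traceLinearMap (Fin (n i)) F F ∘ₗ LinearMap.proj i ∘ₗ
        (φ : S →ₗ[F] Π i, Matrix (Fin (n i)) (Fin (n i)) F))
    have hle : (derivedLieSubalgebra S.asLieSubalgebra).toSubmodule ≤
        T.map S.toSubmodule.subtype := by
      refine Submodule.span_le.mpr ?_
      rintro _ ⟨a, ha, b, hb, rfl⟩
      let a' : S := ⟨a, ha⟩
      let b' : S := ⟨b, hb⟩
      refine ⟨a' * b' - b' * a', ?_, rfl⟩
      change Matrix.trace (φ (a' * b' - b' * a') i) = 0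
      rw [map_sub, map_mul, map_mul]
      change Matrix.trace (φ a' i * φ b' i - φ b' i * φ a' i) = 0
      rw [Matrix.trace_sub, Matrix.trace_mul_comm, sub_self]
    obtain ⟨s, hs, hsx⟩ := hle x.2
    have : subCommutatorToS S x = s := Subtype.ext hsx.symm
    rw [subCommutatorCoords_apply, this]
    exact hs
  exists_eq X hX := by
    classical
    have := Fintype.ofFinite ι
    let R := LinearMap.range (subCommutatorCoords φ)
    have hcomm : ∀ i (Y Z : Matrix (Fin (n i)) (Fin (n i)) F),
        Pi.single i (Y * Z - Z * Y) ∈ R := by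
      intro i Y Z
      obtain ⟨y, hy⟩ := hφ.2 (Pi.single i Y)
      obtain ⟨z, hz⟩ := hφ.2 (Pi.single i Z)
      obtain ⟨x, hx⟩ := exists_subCommutatorToS_eq_comm y z
      refine ⟨x, ?_⟩
      rw [subCommutatorCoords_apply, hx, map_sub, map_mul, map_mul, hy, hz, ← Pi.single_mul,
        ← Pi.single_mul, ← Pi.single_sub]
    have hsingle : ∀ i (Y : Matrix (Fin (n i)) (Fin (n i)) F), Y.trace = 0 → Pi.single i Y ∈ R := by
      intro i Y hY
      have : Y ∈ R.comap (LinearMap.single F (fun i => Matrix (Fin (n i)) (Fin (n i)) F) i) := by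
        refine mem_of_trace_eq_zero (fun k l hkl => ?_) (fun k l => ?_) hY
        · have h1 := hcomm i (single k k 1) (single k l 1)
          rw [single_mul_single_same, single_mul_single_of_ne _ _ _ _ hkl.symm] at h1
          simpa using h1
        · have h1 := hcomm i (single k l 1) (single l k 1)
          rw [single_mul_single_same, single_mul_single_same] at h1
          simpa using h1
      exact this
    have hXR : X ∈ R := by
      rw [← Finset.univ_sum_single X]
      exact Submodule.sum_mem _ fun i _ => hsingle i _ (hX i)
    exact hXR

/-- The matrix coordinates can be chosen so that a given Cartan subalgebra is diagonal. -/
theorem exists_diagonal_coordinates [Finite ι] [CharZero F] [IsAlgClosed F]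
    {φ : S →ₙₐ[F] Π i, Matrix (Fin (n i)) (Fin (n i)) F} (hφ : Function.Bijective φ)
    {𝔥 : LieSubalgebra F (subCommutator S)} (h𝔥 : 𝔥.IsCartanSubalgebra) :
    ∃ φ' : S →ₙₐ[F] Π i, Matrix (Fin (n i)) (Fin (n i)) F, Function.Bijective φ' ∧
      ∀ h ∈ 𝔥, ∀ i k l, k ≠ l → subCommutatorCoords φ' h i k l = 0 := by
  have hθ := isSlCoordinates_subCommutatorCoords hφ
  choose b hb using hθ.exists_basis h𝔥
  -- In each factor, the change to a basis of common eigenvectors of `𝔥`.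
  let τ : (Π i, Matrix (Fin (n i)) (Fin (n i)) F) ≃ₐ[F] Π i, Matrix (Fin (n i)) (Fin (n i)) F :=
    AlgEquiv.piCongrRight fun i =>
      (Matrix.toLinAlgEquiv' (R := F) (n := Fin (n i))).trans (LinearMap.toMatrixAlgEquiv (b i))
  refine ⟨NonUnitalAlgHom.comp (AlgHom.toNonUnitalAlgHom (AlgEquiv.toAlgHom τ)) φ,
    τ.bijective.comp hφ, fun h hh i k l hkl => ?_⟩
  change LinearMap.toMatrixAlgEquiv (b i)
    (Matrix.toLinAlgEquiv' (subCommutatorCoords φ h i)) k l = 0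
  obtain ⟨c, hc⟩ := hb i ⟨h, hh⟩ l
  rw [LinearMap.toMatrixAlgEquiv_apply]
  have : (Matrix.toLinAlgEquiv' (subCommutatorCoords φ h i)) (b i l) = c • b i l := hc
  rw [this]
  simp [hkl.symm]

end Coordinates

/-! ### Matrix units and weights of a diagonal Cartan subalgebra -/

section DiagonalCoordinates

variable {F A : Type*} [Field F] [NonUnitalRing A] [Module F A]
  [IsScalarTower F A A] [SMulCommClass F A A] {S : NonUnitalSubalgebra F A}
  {ι : Type} {n : ι → ℕ}

/-- The elements of the subalgebra `𝔥` of `S⁽¹⁾` as elements of `A`. -/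
def cartanVal (𝔥 : LieSubalgebra F (subCommutator S)) (h : 𝔥) : A :=
  subCommutatorToS S h

/-- The diagonal entry at `p` of the matrices representing `𝔥`. -/
def diagWeight (φ : S →ₙₐ[F] Π i, Matrix (Fin (n i)) (Fin (n i)) F)
    (𝔥 : LieSubalgebra F (subCommutator S)) (p : Σ i, Fin (n i)) : Module.Dual F 𝔥 where
  toFun h := subCommutatorCoords φ h p.1 p.2 p.2
  map_add' x y := by simp
  map_smul' c x := by simp

/-- `𝔥` is a Cartan subalgebra of `S⁽¹⁾` that is diagonal in the matrix coordinates `φ`. -/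
structure IsDiagonalCartan (φ : S →ₙₐ[F] Π i, Matrix (Fin (n i)) (Fin (n i)) F)
    (𝔥 : LieSubalgebra F (subCommutator S)) : Prop where
  bijective : Function.Bijective φ
  two_le : ∀ i, 2 ≤ n i
  cartan : 𝔥.IsCartanSubalgebra
  diagonal : ∀ h ∈ 𝔥, ∀ i k l, k ≠ l → subCommutatorCoords φ h i k l = 0

namespace IsDiagonalCartan

variable {φ : S →ₙₐ[F] Π i, Matrix (Fin (n i)) (Fin (n i)) F}
  {𝔥 : LieSubalgebra F (subCommutator S)}

theorem coords_eq_diagonal (hd : IsDiagonalCartan φ 𝔥) (h : 𝔥) (i : ι) :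
    φ (subCommutatorToS S h) i = Matrix.diagonal fun k => diagWeight φ 𝔥 ⟨i, k⟩ h := by
  ext k l
  by_cases hkl : k = l
  · subst hkl; simp [diagWeight, subCommutatorCoords_apply]
  · rw [Matrix.diagonal_apply_ne _ hkl]
    exact hd.diagonal h h.2 i k l hkl

open Classical in
/-- The element of `S` represented by the matrix unit at `(k, l)` of the component `i`. -/
noncomputable def unitElt (hd : IsDiagonalCartan φ 𝔥) (i : ι) (k l : Fin (n i)) : S :=
  Function.surjInv hd.bijective.2 (Pi.single i (Matrix.single k l 1))

open Classical in
theorem map_unitElt (hd : IsDiagonalCartan φ 𝔥) (i : ι) (k l : Fin (n i)) :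
    φ (hd.unitElt i k l) = Pi.single i (Matrix.single k l 1) :=
  Function.surjInv_eq _ _

theorem unitElt_mul (hd : IsDiagonalCartan φ 𝔥) (i : ι) (j k l : Fin (n i)) :
    hd.unitElt i j k * hd.unitElt i k l = hd.unitElt i j l := by
  classical
  apply hd.bijective.1
  rw [map_mul, map_unitElt, map_unitElt, map_unitElt, ← Pi.single_mul,
    Matrix.single_mul_single_same, mul_one]

/-- The diagonal matrix units. -/
noncomputable def idem (hd : IsDiagonalCartan φ 𝔥) (p : Σ i, Fin (n i)) : S :=
  hd.unitElt p.1 p.2 p.2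

theorem map_sum_idem [Fintype ι] (hd : IsDiagonalCartan φ 𝔥) : φ (∑ p, hd.idem p) = 1 := by
  classical
  rw [map_sum, Fintype.sum_sigma]
  funext i
  rw [Finset.sum_apply, Finset.sum_eq_single i]
  · rw [Finset.sum_apply]
    simp only [idem, map_unitElt, Pi.single_eq_same]
    ext k l
    rw [Matrix.sum_apply]
    simp only [Matrix.single_apply, Pi.one_apply, Matrix.one_apply]
    by_cases hkl : k = l
    · subst hkl; simp
    · rw [if_neg hkl]
      exact Finset.sum_eq_zero fun j _ => if_neg fun h => hkl (h.1.symm.trans h.2)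
  · intro j _ hj
    rw [Finset.sum_apply]
    refine Finset.sum_eq_zero fun k _ => ?_
    rw [idem, map_unitElt, Pi.single_eq_of_ne hj.symm]
  · simp

theorem sum_idem_mul [Fintype ι] (hd : IsDiagonalCartan φ 𝔥) (s : S) :
    (∑ p, hd.idem p) * s = s :=
  hd.bijective.1 (by rw [map_mul, hd.map_sum_idem, one_mul])

theorem mul_sum_idem [Fintype ι] (hd : IsDiagonalCartan φ 𝔥) (s : S) :
    s * ∑ p, hd.idem p = s :=
  hd.bijective.1 (by rw [map_mul, hd.map_sum_idem, mul_one])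

theorem cartan_mul_idem (hd : IsDiagonalCartan φ 𝔥) (h : 𝔥) (p : Σ i, Fin (n i)) :
    subCommutatorToS S h * hd.idem p = diagWeight φ 𝔥 p h • hd.idem p := by
  classical
  apply hd.bijective.1
  rw [map_mul, map_smul, idem, map_unitElt]
  funext i
  rw [Pi.mul_apply, hd.coords_eq_diagonal]
  by_cases hi : i = p.1
  · subst hi
    ext k l
    rw [Pi.smul_apply, Pi.single_eq_same, Matrix.diagonal_mul, Matrix.smul_apply,
      Matrix.single_apply]
    split_ifs with hk
    · rw [← hk.1]; simp
    · simp
  · simp [Pi.single_eq_of_ne hi]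

theorem idem_mul_cartan (hd : IsDiagonalCartan φ 𝔥) (h : 𝔥) (p : Σ i, Fin (n i)) :
    hd.idem p * subCommutatorToS S h = diagWeight φ 𝔥 p h • hd.idem p := by
  classical
  apply hd.bijective.1
  rw [map_mul, map_smul, idem, map_unitElt]
  funext i
  rw [Pi.mul_apply, hd.coords_eq_diagonal]
  by_cases hi : i = p.1
  · subst hi
    ext k l
    rw [Pi.smul_apply, Pi.single_eq_same, Matrix.mul_diagonal, Matrix.smul_apply,
      Matrix.single_apply]
    split_ifs with hk
    · rw [← hk.2]; simp
    · simp
  · simp [Pi.single_eq_of_ne hi]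

theorem coe_sum_idem [Fintype ι] (hd : IsDiagonalCartan φ 𝔥) :
    ∑ p, (hd.idem p : A) = ((∑ p, hd.idem p : S) : A) :=
  (map_sum S.toSubmodule.subtype _ _).symm

theorem isWeightedIdempotents [Fintype ι] (hd : IsDiagonalCartan φ 𝔥) :
    IsWeightedIdempotents (cartanVal 𝔥) (fun p => (hd.idem p : A)) (diagWeight φ 𝔥) where
  idem p := congrArg (fun s : S => (s : A)) (hd.unitElt_mul p.1 p.2 p.2 p.2)
  mul_idem h p := congrArg (fun s : S => (s : A)) (hd.cartan_mul_idem h p)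
  idem_mul h p := congrArg (fun s : S => (s : A)) (hd.idem_mul_cartan h p)
  mul_sum h := by
    rw [hd.coe_sum_idem]
    exact congrArg (fun s : S => (s : A)) (hd.mul_sum_idem _)
  sum_mul h := by
    rw [hd.coe_sum_idem]
    exact congrArg (fun s : S => (s : A)) (hd.sum_idem_mul _)

variable [Finite ι]

theorem isSlCoordinates (hd : IsDiagonalCartan φ 𝔥) : IsSlCoordinates (subCommutatorCoords φ) :=
  isSlCoordinates_subCommutatorCoords hd.bijective

theorem diagWeight_ne (hd : IsDiagonalCartan φ 𝔥) {i : ι} {k l : Fin (n i)} (hkl : k ≠ l) :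
    diagWeight φ 𝔥 ⟨i, k⟩ ≠ diagWeight φ 𝔥 ⟨i, l⟩ := by
  obtain ⟨h, hh, hne⟩ := hd.isSlCoordinates.exists_diag_ne hd.cartan hd.diagonal hkl
  exact fun heq => hne (LinearMap.congr_fun heq ⟨h, hh⟩)

/-- Size at least two, which comes from `1`-perfectness, gives two distinct diagonal weights, and at
most one of them is `γ`. -/
theorem exists_diagWeight_ne (hd : IsDiagonalCartan φ 𝔥) (i : ι) (γ : Module.Dual F 𝔥) :
    ∃ k, diagWeight φ 𝔥 ⟨i, k⟩ ≠ γ := by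
  have h2 := hd.two_le i
  have h01 : (⟨0, by omega⟩ : Fin (n i)) ≠ ⟨1, by omega⟩ := by simp
  by_contra! h
  exact hd.diagWeight_ne h01 ((h _).trans (h _).symm)

/-- The idempotents of weight different from a given one generate `A`. -/
theorem mem_span_mul_idem_mul (hd : IsDiagonalCartan φ 𝔥)
    (hA : GeneratedAsIdeal F (S : Set A)) (γ : Module.Dual F 𝔥) (x : A) :
    x ∈ Submodule.span F
      {z | ∃ p, diagWeight φ 𝔥 p ≠ γ ∧ ∃ b c : A, b * (hd.idem p : A) * c = z} := by
  have := Fintype.ofFinite ι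
  set J := Submodule.span F
      {z | ∃ p, diagWeight φ 𝔥 p ≠ γ ∧ ∃ b c : A, b * (hd.idem p : A) * c = z} with hJ
  have hideal : IsAlgIdeal F J := by
    intro b x hx
    constructor
    · have hle : J ≤ J.comap (LinearMap.mulLeft F b) := by
        refine Submodule.span_le.mpr ?_
        rintro _ ⟨p, hp, c, d, rfl⟩
        exact Submodule.subset_span ⟨p, hp, b * c, d, by simp [mul_assoc]⟩
      exact hle hx
    · have hle : J ≤ J.comap (LinearMap.mulRight F b) := by
        refine Submodule.span_le.mpr ?_
        rintro _ ⟨p, hp, c, d, rfl⟩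
        exact Submodule.subset_span ⟨p, hp, c, d * b, by simp [mul_assoc]⟩
      exact hle hx
  have hSJ : (S : Set A) ⊆ J := by
    intro s hs
    have h1 : s = ∑ p, (hd.idem p : A) * s := by
      rw [← Finset.sum_mul, hd.coe_sum_idem]
      exact (congrArg (fun s : S => (s : A)) (hd.sum_idem_mul ⟨s, hs⟩)).symm
    rw [h1]
    refine Submodule.sum_mem _ fun p _ => ?_
    -- Any diagonal unit of a component is `E_kl E_ll E_lk`, so the position `l` can be chosen with
    -- weight different from `γ`.
    obtain ⟨l, hl⟩ := hd.exists_diagWeight_ne p.1 γ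
    refine Submodule.subset_span ⟨⟨p.1, l⟩, hl, hd.unitElt p.1 p.2 l, hd.unitElt p.1 l p.2 * s, ?_⟩
    have h2 : hd.unitElt p.1 p.2 l * hd.idem ⟨p.1, l⟩ * hd.unitElt p.1 l p.2 = hd.idem p := by
      rw [idem, hd.unitElt_mul, hd.unitElt_mul]; rfl
    rw [← mul_assoc]
    exact congrArg (fun t : S => (t : A) * s) h2
  rw [hA J hideal hSJ]
  trivial

/-! #### Weights of the natural and conatural modules -/

theorem isAtom_component [CharZero F] (hd : IsDiagonalCartan φ 𝔥) (i : ι) :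
    IsAtom (hd.isSlCoordinates.component i) :=
  hd.isSlCoordinates.isAtom_component (hd.two_le i)

theorem isNaturalRep (hd : IsDiagonalCartan φ 𝔥) (i : ι) :
    IsNaturalRep S (hd.isSlCoordinates.component i) (n i)
      ((Pi.evalAlgHom F (fun i => Matrix (Fin (n i)) (Fin (n i)) F) i :
        (Π i, Matrix (Fin (n i)) (Fin (n i)) F) →ₙₐ[F] _).comp φ) := by
  classical
  refine ⟨fun X => ?_, fun x _ => ?_, fun x hx y hy hxy => ?_, fun X hX => ?_⟩
  · obtain ⟨s, hs⟩ := hd.bijective.2 (Pi.single i X)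
    refine ⟨s, ?_⟩
    change φ s i = X
    rw [hs, Pi.single_eq_same]
  · exact hd.isSlCoordinates.trace_eq_zero x i
  · exact hd.isSlCoordinates.ext_component hx hy hxy
  · obtain ⟨x, hx, hxi⟩ := hd.isSlCoordinates.exists_component (show Matrix.trace X = 0 from hX)
    exact ⟨x, hx, hxi⟩

theorem diagWeight_mem_naturalWeights (hd : IsDiagonalCartan φ 𝔥) (p : Σ i, Fin (n i)) :
    diagWeight φ 𝔥 p ∈ naturalWeights S 𝔥 (hd.isSlCoordinates.component p.1) := by
  refine ⟨_, _, hd.isNaturalRep p.1, Pi.single p.2 1, by simp, fun h => ?_⟩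
  change Matrix.mulVec (φ (subCommutatorToS S h) p.1) _ = _
  rw [hd.coords_eq_diagonal]
  ext k
  rw [Matrix.mulVec_diagonal]
  by_cases hk : k = p.2
  · subst hk; simp
  · simp [hk]

theorem neg_diagWeight_mem_conaturalWeights (hd : IsDiagonalCartan φ 𝔥) (p : Σ i, Fin (n i)) :
    -diagWeight φ 𝔥 p ∈ conaturalWeights S 𝔥 (hd.isSlCoordinates.component p.1) := by
  refine ⟨_, _, hd.isNaturalRep p.1, Pi.single p.2 1, by simp, fun h => ?_⟩
  change -Matrix.vecMul _ (φ (subCommutatorToS S h) p.1) = _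
  rw [hd.coords_eq_diagonal]
  ext k
  rw [Pi.neg_apply, Matrix.vecMul_diagonal]
  by_cases hk : k = p.2
  · subst hk; simp
  · simp [hk]

/-- Every weight of a representation of `S` on column vectors is one of the diagonal weights. -/
theorem exists_eq_diagWeight (hd : IsDiagonalCartan φ 𝔥) {m : ℕ}
    {ρ : S →ₙₐ[F] Matrix (Fin m) (Fin m) F} (hρ : Function.Surjective ρ) {v : Fin m → F}
    (hv : v ≠ 0) {μ : Module.Dual F 𝔥}
    (hμ : ∀ h : 𝔥, Matrix.mulVec (ρ (subCommutatorToS S h)) v = μ h • v) :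
    ∃ p, μ = diagWeight φ 𝔥 p := by
  have := Fintype.ofFinite ι
  obtain ⟨s, hs⟩ := hρ 1
  have h1 : ρ (∑ p, hd.idem p) = 1 := by
    have h2 := congrArg ρ (hd.sum_idem_mul s)
    rwa [map_mul, hs, mul_one] at h2
  -- The idempotents add up to the identity under `ρ`, so one of them does not kill `v`. Evaluating
  -- `ρ (e_p h) v` in two ways then identifies `μ`.
  obtain ⟨p, hp⟩ : ∃ p, Matrix.mulVec (ρ (hd.idem p)) v ≠ 0 := by
    by_contra! h0
    apply hv
    rw [← Matrix.one_mulVec v, ← h1, map_sum, Matrix.sum_mulVec]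
    exact Finset.sum_eq_zero fun p _ => h0 p
  refine ⟨p, LinearMap.ext fun h => ?_⟩
  have h3 := congrArg (fun s => Matrix.mulVec (ρ s) v) (hd.idem_mul_cartan h p)
  simp only [map_mul, map_smul] at h3
  rw [← Matrix.mulVec_mulVec, hμ, Matrix.mulVec_smul, Matrix.smul_mulVec] at h3
  exact smul_left_injective F hp h3

theorem exists_eq_neg_diagWeight (hd : IsDiagonalCartan φ 𝔥) {m : ℕ}
    {ρ : S →ₙₐ[F] Matrix (Fin m) (Fin m) F} (hρ : Function.Surjective ρ) {v : Fin m → F}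
    (hv : v ≠ 0) {μ : Module.Dual F 𝔥}
    (hμ : ∀ h : 𝔥, -Matrix.vecMul v (ρ (subCommutatorToS S h)) = μ h • v) :
    ∃ p, μ = -diagWeight φ 𝔥 p := by
  have := Fintype.ofFinite ι
  obtain ⟨s, hs⟩ := hρ 1
  have h1 : ρ (∑ p, hd.idem p) = 1 := by
    have h2 := congrArg ρ (hd.sum_idem_mul s)
    rwa [map_mul, hs, mul_one] at h2
  obtain ⟨p, hp⟩ : ∃ p, Matrix.vecMul v (ρ (hd.idem p)) ≠ 0 := by
    by_contra! h0
    apply hv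
    rw [← Matrix.vecMul_one v, ← h1, map_sum, Matrix.vecMul_sum]
    exact Finset.sum_eq_zero fun p _ => h0 p
  refine ⟨p, LinearMap.ext fun h => ?_⟩
  have h3 := congrArg (fun s => Matrix.vecMul v (ρ s)) (hd.cartan_mul_idem h p)
  simp only [map_mul, map_smul] at h3
  have hμ' : Matrix.vecMul v (ρ (subCommutatorToS S h)) = (-μ h) • v := by
    rw [neg_smul, ← hμ h, neg_neg]
  rw [← Matrix.vecMul_vecMul, hμ', Matrix.smul_vecMul, Matrix.vecMul_smul] at h3
  rw [LinearMap.neg_apply, ← smul_left_injective F hp h3, neg_neg]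

end IsDiagonalCartan

end DiagonalCoordinates

/-! ### The set `Γ` and the grading of `A⁽¹⁾` -/

section Grading

variable {F A : Type*} [Field F] [NonUnitalRing A] [Module F A]
  [IsScalarTower F A A] [SMulCommClass F A A] {S : NonUnitalSubalgebra F A}
  {ι : Type} {n : ι → ℕ}

/-! ### Integrality of the weights -/

theorem IsSl2Triple.subCommutatorToS {h e f : subCommutator S} (t : IsSl2Triple h e f) {m : ℕ}
    (ρ : S →ₙₐ[F] Matrix (Fin m) (Fin m) F) :
    ρ (subCommutatorToS S e) * ρ (subCommutatorToS S f) -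
        ρ (subCommutatorToS S f) * ρ (subCommutatorToS S e) = ρ (subCommutatorToS S h) ∧
      ρ (subCommutatorToS S h) * ρ (subCommutatorToS S e) -
        ρ (subCommutatorToS S e) * ρ (subCommutatorToS S h) = 2 • ρ (subCommutatorToS S e) ∧
      ρ (subCommutatorToS S h) * ρ (subCommutatorToS S f) -
        ρ (subCommutatorToS S f) * ρ (subCommutatorToS S h) = -(2 • ρ (subCommutatorToS S f)) := by
  have hlie : ∀ x y : subCommutator S, ρ (_root_.subCommutatorToS S x) *
      ρ (_root_.subCommutatorToS S y) - ρ (_root_.subCommutatorToS S y) *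
      ρ (_root_.subCommutatorToS S x) = ρ (_root_.subCommutatorToS S ⁅x, y⁆) := by
    intro x y
    rw [subCommutatorToS_lie, map_sub, map_mul, map_mul]
  have hnsmul : ∀ x : subCommutator S, ρ (_root_.subCommutatorToS S (2 • x)) =
      2 • ρ (_root_.subCommutatorToS S x) := by
    intro x
    change ρ (subCommutatorToSLinear S (2 • x)) = 2 • ρ (subCommutatorToSLinear S x)
    rw [map_nsmul, map_nsmul]
  have hneg : ∀ x : subCommutator S, ρ (_root_.subCommutatorToS S (-x)) =
      -ρ (_root_.subCommutatorToS S x) := by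
    intro x
    change ρ (subCommutatorToSLinear S (-x)) = -ρ (subCommutatorToSLinear S x)
    rw [map_neg, map_neg]
  refine ⟨?_, ?_, ?_⟩
  · rw [hlie, t.lie_e_f]
  · rw [hlie, t.lie_h_e_nsmul, hnsmul]
  · rw [hlie, t.lie_h_f_nsmul, hneg, hnsmul]

theorem isIntegralWeight_of_mem_rootSet [CharZero F] [FiniteDimensional F (subCommutator S)]
    {𝔥 : LieSubalgebra F (subCommutator S)} {μ : Module.Dual F 𝔥} (hμ : μ ∈ rootSet 𝔥) :
    IsIntegralWeight 𝔥 μ := by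
  rintro α - h ⟨e, -, f, -, t⟩
  obtain ⟨x, hx, hx0⟩ := (Submodule.ne_bot_iff _).mp hμ.2
  exact t.exists_int_eq_of_eigenvector hx0 (hx h)

theorem isIntegralWeight_of_mem_naturalWeights [CharZero F]
    {𝔥 : LieSubalgebra F (subCommutator S)} {Q : LieIdeal F (subCommutator S)}
    {μ : Module.Dual F 𝔥} (hμ : μ ∈ naturalWeights S 𝔥 Q) : IsIntegralWeight 𝔥 μ := by
  rintro α - h ⟨e, -, f, -, t⟩
  obtain ⟨m, ρ, -, v, hv, hw⟩ := hμ
  obtain ⟨h1, h2, h3⟩ := t.subCommutatorToS ρ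
  exact exists_int_eq_of_matrix_triple h1 h2 h3 hv (hw h)

theorem isIntegralWeight_of_mem_conaturalWeights [CharZero F]
    {𝔥 : LieSubalgebra F (subCommutator S)} {Q : LieIdeal F (subCommutator S)}
    {μ : Module.Dual F 𝔥} (hμ : μ ∈ conaturalWeights S 𝔥 Q) : IsIntegralWeight 𝔥 μ := by
  rintro α - h ⟨e, -, f, -, t⟩
  obtain ⟨m, ρ, -, v, hv, hw⟩ := hμ
  obtain ⟨h1, h2, h3⟩ := t.subCommutatorToS ρ
  -- The negative transpose preserves commutators and turns the action on rows into one on columns.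
  have hc : (-(ρ (subCommutatorToS S h)).transpose).mulVec v = μ h • v := by
    rw [Matrix.neg_mulVec, Matrix.mulVec_transpose]
    exact hw h
  refine exists_int_eq_of_matrix_triple (e := -(ρ (subCommutatorToS S e)).transpose)
    (f := -(ρ (subCommutatorToS S f)).transpose) ?_ ?_ ?_ hv hc
  · rw [← h1, Matrix.transpose_sub, Matrix.transpose_mul, Matrix.transpose_mul]
    noncomm_ring
  · have := congrArg Matrix.transpose h2
    rw [Matrix.transpose_sub, Matrix.transpose_mul, Matrix.transpose_mul,
      Matrix.transpose_smul] at this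
    rw [smul_neg, ← this]
    noncomm_ring
  · have := congrArg Matrix.transpose h3
    rw [Matrix.transpose_sub, Matrix.transpose_mul, Matrix.transpose_mul, Matrix.transpose_neg,
      Matrix.transpose_smul] at this
    rw [smul_neg, ← this]
    noncomm_ring

theorem isIntegralWeight_zero {𝔥 : LieSubalgebra F (subCommutator S)} :
    IsIntegralWeight 𝔥 (0 : Module.Dual F 𝔥) :=
  fun _ _ _ _ => ⟨0, by simp⟩

theorem isIntegralWeight_of_mem_componentWeights [CharZero F]
    {𝔥 : LieSubalgebra F (subCommutator S)} {Q : LieIdeal F (subCommutator S)}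
    {μ : Module.Dual F 𝔥} (hμ : μ ∈ componentWeights S 𝔥 Q) : IsIntegralWeight 𝔥 μ := by
  rcases hμ with (rfl | hμ) | hμ
  · exact isIntegralWeight_zero
  · exact isIntegralWeight_of_mem_naturalWeights hμ
  · exact isIntegralWeight_of_mem_conaturalWeights hμ

theorem IsIntegralWeight.add {𝔥 : LieSubalgebra F (subCommutator S)} {μ ν : Module.Dual F 𝔥}
    (hμ : IsIntegralWeight 𝔥 μ) (hν : IsIntegralWeight 𝔥 ν) : IsIntegralWeight 𝔥 (μ + ν) := by
  intro α hα h hh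
  obtain ⟨a, ha⟩ := hμ α hα h hh
  obtain ⟨b, hb⟩ := hν α hα h hh
  exact ⟨a + b, by simp [ha, hb]⟩

theorem isIntegralWeight_of_mem_gradingWeights [CharZero F]
    [FiniteDimensional F (subCommutator S)]
    {𝔥 : LieSubalgebra F (subCommutator S)} {μ : Module.Dual F 𝔥}
    (hμ : μ ∈ gradingWeights S 𝔥) : IsIntegralWeight 𝔥 μ := by
  rcases hμ with (hμ | ⟨Q, -, hμ⟩) | ⟨Q, Q', -, -, -, μ, hμ, ν, hν, rfl⟩
  · exact isIntegralWeight_of_mem_rootSet hμ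
  · exact isIntegralWeight_of_mem_componentWeights hμ
  · exact (isIntegralWeight_of_mem_componentWeights hμ).add
      (isIntegralWeight_of_mem_componentWeights hν)

namespace IsDiagonalCartan

variable {φ : S →ₙₐ[F] Π i, Matrix (Fin (n i)) (Fin (n i)) F}
  {𝔥 : LieSubalgebra F (subCommutator S)}

/-! ### The weight spaces of `S⁽¹⁾` and `A⁽¹⁾` -/

/-- The inclusion of `S⁽¹⁾` in `A`. -/
def _root_.subCommutatorIncl (S : NonUnitalSubalgebra F A) : subCommutator S →ₗ[F] A :=
  (algCommutator F A).toSubmodule.subtype ∘ₗ (subCommutator S).toSubmodule.subtype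

theorem _root_.subCommutatorIncl_injective : Function.Injective (subCommutatorIncl S) :=
  Subtype.val_injective.comp Subtype.val_injective

theorem mem_eigSpace_algCommutator {γ : Module.Dual F 𝔥} {x : algCommutator F A} :
    x ∈ eigSpace (algCommutator F A) γ ↔ (x : A) ∈ commWeightSpace (cartanVal 𝔥) γ :=
  mem_eigSpace_iff_mem_commWeightSpace (j := (algCommutator F A).toSubmodule.subtype)
    Subtype.val_injective fun _ _ => rfl

theorem mem_eigSpace_subCommutator {γ : Module.Dual F 𝔥} {x : subCommutator S} :
    x ∈ eigSpace (subCommutator S) γ ↔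
      subCommutatorIncl S x ∈ commWeightSpace (cartanVal 𝔥) γ :=
  mem_eigSpace_iff_mem_commWeightSpace (j := subCommutatorIncl S)
    subCommutatorIncl_injective fun _ _ => rfl

theorem iSup_eigSpace_algCommutator [Fintype ι] (hd : IsDiagonalCartan φ 𝔥) :
    ⨆ α : Module.Dual F 𝔥, eigSpace (algCommutator F A) α = ⊤ :=
  hd.isWeightedIdempotents.iSup_eigSpace_eq_top
    (j := (algCommutator F A).toSubmodule.subtype) Subtype.val_injective (fun _ _ => rfl) ⊤
    (fun _ _ _ _ => trivial) (fun _ => trivial)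
    fun h x _ => ⟨⟨_, mem_algCommutator (cartanVal 𝔥 h) x⟩, rfl⟩

/-- The Peirce projections preserve `S`, since the idempotents lie in it, and commutators of `𝔥`
with `S` lie in `S⁽¹⁾`. -/
theorem iSup_eigSpace_subCommutator [Fintype ι] (hd : IsDiagonalCartan φ 𝔥) :
    ⨆ α : Module.Dual F 𝔥, eigSpace (subCommutator S) α = ⊤ := by
  have hsum : ∑ p, (hd.idem p : A) ∈ S.toSubmodule := by
    rw [hd.coe_sum_idem]; exact Subtype.property _
  refine hd.isWeightedIdempotents.iSup_eigSpace_eq_top (j := subCommutatorIncl S)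
    subCommutatorIncl_injective (fun _ _ => rfl) S.toSubmodule (fun i k x hx => ?_)
    (fun x => (subCommutatorToS S x).2) fun h x hx => ?_
  · have hl : ∀ i, ∀ y ∈ S.toSubmodule,
        peirceLeft F (fun p => (hd.idem p : A)) i y ∈ S.toSubmodule := by
      rintro (_ | p) y hy
      · exact sub_mem hy (S.mul_mem hsum hy)
      · exact S.mul_mem (hd.idem p).2 hy
    have hr : ∀ i, ∀ y ∈ S.toSubmodule,
        peirceRight F (fun p => (hd.idem p : A)) i y ∈ S.toSubmodule := by
      rintro (_ | p) y hy
      · exact sub_mem hy (S.mul_mem hy hsum)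
      · exact S.mul_mem hy (hd.idem p).2
    exact hl i _ (hr k x hx)
  · obtain ⟨y, hy⟩ := exists_subCommutatorToS_eq_comm (subCommutatorToS S h) ⟨x, hx⟩
    exact ⟨y, congrArg (fun s : S => (s : A)) hy⟩

theorem finite_gradingWeights [Finite ι] (hd : IsDiagonalCartan φ 𝔥) :
    (gradingWeights S 𝔥).Finite := by
  have := Fintype.ofFinite ι
  let C : Set (Module.Dual F 𝔥) :=
    {0} ∪ Set.range (diagWeight φ 𝔥) ∪ Set.range fun p => -diagWeight φ 𝔥 p
  have hC : C.Finite :=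
    ((Set.finite_singleton _).union (Set.finite_range _)).union (Set.finite_range _)
  -- The definition of the weights ranges over all sizes and all `ρ`, yet only the finitely many
  -- diagonal weights and their negatives can occur.
  have hcomp : ∀ Q, componentWeights S 𝔥 Q ⊆ C := by
    rintro Q μ ((h | ⟨m, ρ, hρ, v, hv, hw⟩) | ⟨m, ρ, hρ, v, hv, hw⟩)
    · exact Or.inl (Or.inl h)
    · obtain ⟨p, rfl⟩ := hd.exists_eq_diagWeight hρ.1 hv hw
      exact Or.inl (Or.inr ⟨p, rfl⟩)
    · obtain ⟨p, rfl⟩ := hd.exists_eq_neg_diagWeight hρ.1 hv hw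
      exact Or.inr ⟨p, rfl⟩
  have hroot : rootSet 𝔥 ⊆ Set.range fun ij : Option (Σ i, Fin (n i)) × Option (Σ i, Fin (n i)) =>
      peirceWeight (diagWeight φ 𝔥) ij.1 - peirceWeight (diagWeight φ 𝔥) ij.2 := by
    rintro α ⟨-, hα⟩
    obtain ⟨x, hx, hx0⟩ := (Submodule.ne_bot_iff _).mp hα
    obtain ⟨i, j, rfl, -⟩ := hd.isWeightedIdempotents.exists_of_ne_zero
      (mem_eigSpace_subCommutator.mp hx)
      fun h0 => hx0 (subCommutatorIncl_injective (h0.trans (map_zero _).symm))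
    exact ⟨(i, j), rfl⟩
  refine (((Set.finite_range _).subset hroot).union (hC.subset ?_)).union
    ((Set.Finite.image2 (fun μ ν => μ + ν) hC hC).subset ?_)
  · rintro μ ⟨Q, -, hμ⟩
    exact hcomp Q hμ
  · rintro γ ⟨Q, Q', -, -, -, μ, hμ, ν, hν, rfl⟩
    exact ⟨μ, hcomp Q hμ, ν, hcomp Q' hν, rfl⟩

variable [CharZero F]

theorem isLieAbelian [Finite ι] (hd : IsDiagonalCartan φ 𝔥) : IsLieAbelian 𝔥 :=
  hd.isSlCoordinates.isLieAbelian hd.cartan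

/-- The differences of distinct diagonal weights of a component are roots. -/
theorem sub_mem_rootSet [Finite ι] (hd : IsDiagonalCartan φ 𝔥) {i : ι} {k l : Fin (n i)}
    (hkl : k ≠ l) : diagWeight φ 𝔥 ⟨i, k⟩ - diagWeight φ 𝔥 ⟨i, l⟩ ∈ rootSet 𝔥 := by
  have hθ := hd.isSlCoordinates
  refine ⟨sub_ne_zero.mpr (hd.diagWeight_ne hkl), (Submodule.ne_bot_iff _).mpr ?_⟩
  obtain ⟨x, hx, hxi⟩ := hθ.exists_component_single hkl
  refine ⟨x, fun h => ?_, fun h0 => ?_⟩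
  · change ⁅(h : subCommutator S), x⁆ = _
    refine hθ.ext_component ((hθ.component i).lie_mem hx) ((hθ.component i).smul_mem _ hx) ?_
    rw [hθ.map_lie, map_smul, Pi.smul_apply, hxi, ← neg_sub,
      comm_single_of_diagonal (hd.diagonal h h.2 i), ← neg_smul, neg_sub]
    rfl
  · rw [h0, map_zero] at hxi
    have := congrFun (congrFun hxi k) l
    simp at this

theorem zero_mem_gradingWeights [Finite ι] [Nonempty ι] (hd : IsDiagonalCartan φ 𝔥) :
    (0 : Module.Dual F 𝔥) ∈ gradingWeights S 𝔥 :=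
  Or.inl (Or.inr ⟨_, hd.isAtom_component (Classical.arbitrary ι), Or.inl (Or.inl rfl)⟩)

/-- This accounts for the shape of `Γ`. Two positions in one component give a root or zero, two in
different components a natural plus a conatural weight, and the complement `none` paired with a
position a single such weight. -/
theorem peirceWeight_sub_mem [Finite ι] [Nonempty ι] (hd : IsDiagonalCartan φ 𝔥)
    (i j : Option (Σ i, Fin (n i))) :
    peirceWeight (diagWeight φ 𝔥) i - peirceWeight (diagWeight φ 𝔥) j ∈ gradingWeights S 𝔥 := by
  have hnat : ∀ p, diagWeight φ 𝔥 p ∈ componentWeights S 𝔥 (hd.isSlCoordinates.component p.1) :=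
    fun p => Or.inl (Or.inr (hd.diagWeight_mem_naturalWeights p))
  have hconat : ∀ p,
      -diagWeight φ 𝔥 p ∈ componentWeights S 𝔥 (hd.isSlCoordinates.component p.1) :=
    fun p => Or.inr (hd.neg_diagWeight_mem_conaturalWeights p)
  rcases i with _ | p <;> rcases j with _ | q
  · simpa [peirceWeight] using hd.zero_mem_gradingWeights
  · simp only [peirceWeight, zero_sub]
    exact Or.inl (Or.inr ⟨_, hd.isAtom_component q.1, hconat q⟩)
  · simp only [peirceWeight, sub_zero]
    exact Or.inl (Or.inr ⟨_, hd.isAtom_component p.1, hnat p⟩)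
  · simp only [peirceWeight]
    by_cases hpq : p.1 = q.1
    · obtain ⟨i, k⟩ := p
      obtain ⟨i', l⟩ := q
      obtain rfl : i = i' := hpq
      by_cases hkl : k = l
      · subst hkl
        rw [sub_self]
        exact hd.zero_mem_gradingWeights
      · exact Or.inl (Or.inl (hd.sub_mem_rootSet hkl))
    · refine Or.inr ⟨_, _, hd.isAtom_component p.1, hd.isAtom_component q.1,
        fun h => hpq (hd.isSlCoordinates.component_injective hd.two_le h), _, hnat p, _,
        hconat q, sub_eq_add_neg _ _⟩

theorem mem_gradingWeights_of_ne_zero [Finite ι] [Nonempty ι] (hd : IsDiagonalCartan φ 𝔥)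
    {γ : Module.Dual F 𝔥} {x : A} (hx : x ∈ commWeightSpace (cartanVal 𝔥) γ) (hx0 : x ≠ 0) :
    γ ∈ gradingWeights S 𝔥 := by
  have := Fintype.ofFinite ι
  obtain ⟨i, j, rfl, -⟩ := hd.isWeightedIdempotents.exists_of_ne_zero hx hx0
  exact hd.peirceWeight_sub_mem i j

/-- The zero eigenspace is the centralizer of `𝔥`, which is `𝔥` because `𝔥` is abelian and
self-normalizing. -/
theorem isSplitSemisimple [Finite ι] (hd : IsDiagonalCartan φ 𝔥) : IsSplitSemisimple 𝔥 := by
  have := Fintype.ofFinite ι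
  have hθ := hd.isSlCoordinates
  have hfin := hθ.finiteDimensional
  have := hθ.hasTrivialRadical
  have := hd.isLieAbelian
  refine ⟨hfin, inferInstance, hd.cartan, ?_, iSupIndep_eigSpace.comp Subtype.val_injective,
    iSup_eigSpace_subtype_eq_top hd.iSup_eigSpace_subCommutator fun α hα => ?_⟩
  · ext x
    constructor
    · intro hx
      refine hd.cartan.mem_of_forall_lie_eq_zero fun h hh => ?_
      have h0 : ⁅h, x⁆ = (0 : Module.Dual F 𝔥) ⟨h, hh⟩ • x := hx ⟨h, hh⟩
      rw [← lie_skew, h0]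
      simp
    · intro hx h
      have h0 : (⁅h, (⟨x, hx⟩ : 𝔥)⁆ : 𝔥) = 0 := trivial_lie_zero _ _ _ _
      have h1 : ⁅(h : subCommutator S), x⁆ = 0 := congrArg Subtype.val h0
      rw [LinearMap.zero_apply, zero_smul]
      exact h1
  · by_cases h0 : α = 0
    · exact Or.inl h0
    · exact Or.inr ⟨h0, hα⟩

/-- The zero weight space of `A⁽¹⁾`. -/
theorem eigSpace_zero_eq [Finite ι] [Nonempty ι] (hd : IsDiagonalCartan φ 𝔥)
    (hA : GeneratedAsIdeal F (S : Set A)) :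
    eigSpace (algCommutator F A) (0 : Module.Dual F 𝔥) =
      Submodule.span F {z | ∃ α ∈ gradingWeights S 𝔥 \ {0}, -α ∈ gradingWeights S 𝔥 \ {0} ∧
        ∃ x ∈ eigSpace (algCommutator F A) α, ∃ y ∈ eigSpace (algCommutator F A) (-α),
          ⁅x, y⁆ = z} := by
  have := Fintype.ofFinite ι
  have he := hd.isWeightedIdempotents
  apply le_antisymm
  · intro x hx
    rw [mem_eigSpace_algCommutator] at hx
    have hcomm : (algCommutator F A).toSubmodule ≤
        (IsWeightedIdempotents.oppositeCommutators F (cartanVal 𝔥)).comap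
          (zeroProj (fun p => (hd.idem p : A)) (diagWeight φ 𝔥)) := by
      refine Submodule.span_le.mpr ?_
      rintro _ ⟨y, -, z, -, rfl⟩
      exact he.zeroProj_comm_mem (hd.mem_span_mul_idem_mul hA) y z
    have hxN : (x : A) ∈ IsWeightedIdempotents.oppositeCommutators F (cartanVal 𝔥) := by
      rw [← he.zeroProj_eq_self hx]
      exact hcomm x.2
    set W := Submodule.span F {z | ∃ α ∈ gradingWeights S 𝔥 \ {0}, -α ∈ gradingWeights S 𝔥 \ {0} ∧
        ∃ x ∈ eigSpace (algCommutator F A) α, ∃ y ∈ eigSpace (algCommutator F A) (-α),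
          ⁅x, y⁆ = z} with hW
    -- `y` is a multiple of `[h, y]` for any `h` with `α h ≠ 0`.
    have hlift : ∀ {α : Module.Dual F 𝔥} {y : A}, α ≠ 0 → y ∈ commWeightSpace (cartanVal 𝔥) α →
        y ∈ algCommutator F A := by
      intro α y hα hy
      obtain ⟨h, hh⟩ : ∃ h, α h ≠ 0 := by
        by_contra! h0
        exact hα (LinearMap.ext h0)
      have h1 := mem_algCommutator (F := F) (cartanVal 𝔥 h) y
      rw [hy h] at h1
      exact (Submodule.smul_mem_iff _ hh).mp h1
    have hle : IsWeightedIdempotents.oppositeCommutators F (cartanVal 𝔥) ≤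
        W.map (algCommutator F A).toSubmodule.subtype := by
      refine Submodule.span_le.mpr ?_
      rintro _ ⟨α, hα, y, hy, z, hz, rfl⟩
      -- Only a nonzero vector certifies that its weight belongs to `Γ`.
      by_cases hy0 : y = 0
      · rw [hy0]; simp
      by_cases hz0 : z = 0
      · rw [hz0]; simp
      have hα' : -α ≠ 0 := neg_ne_zero.mpr hα
      refine ⟨⁅(⟨y, hlift hα hy⟩ : algCommutator F A), ⟨z, hlift hα' hz⟩⁆, ?_, rfl⟩
      exact Submodule.subset_span ⟨α, ⟨hd.mem_gradingWeights_of_ne_zero hy hy0, hα⟩,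
        ⟨hd.mem_gradingWeights_of_ne_zero hz hz0, hα'⟩, _, mem_eigSpace_algCommutator.mpr hy, _,
        mem_eigSpace_algCommutator.mpr hz, rfl⟩
    obtain ⟨w, hw, hwx⟩ := hle hxN
    rwa [← Subtype.ext hwx]
  · refine Submodule.span_le.mpr ?_
    rintro _ ⟨α, -, -, x, hx, y, hy, rfl⟩
    have h1 := comm_mem_commWeightSpace (mem_eigSpace_algCommutator.mp hx)
      (mem_eigSpace_algCommutator.mp hy)
    rw [add_neg_cancel] at h1
    exact mem_eigSpace_algCommutator.mpr h1

theorem isRootGraded [Finite ι] [Nonempty ι] (hd : IsDiagonalCartan φ 𝔥)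
    (hA : GeneratedAsIdeal F (S : Set A)) :
    IsRootGraded (subCommutator S) 𝔥 (gradingWeights S 𝔥) := by
  have := Fintype.ofFinite ι
  have hfin := hd.isSlCoordinates.finiteDimensional
  have := hd.isLieAbelian
  refine ⟨hd.finite_gradingWeights, fun μ hμ => isIntegralWeight_of_mem_gradingWeights hμ,
    fun α hα => Or.inl (Or.inl hα), hd.zero_mem_gradingWeights, hd.isSplitSemisimple,
    iSupIndep_eigSpace.comp Subtype.val_injective,
    iSup_eigSpace_subtype_eq_top hd.iSup_eigSpace_algCommutator fun α hα => ?_,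
    hd.eigSpace_zero_eq hA⟩
  obtain ⟨x, hx, hx0⟩ := (Submodule.ne_bot_iff _).mp hα
  exact hd.mem_gradingWeights_of_ne_zero (mem_eigSpace_algCommutator.mp hx)
    fun h0 => hx0 (Subtype.ext h0)

end IsDiagonalCartan

end Grading

theorem theorem1p3 {F A : Type*} [Field F] [IsAlgClosed F] [CharZero F]
    [NonUnitalRing A] [Module F A] [IsScalarTower F A A] [SMulCommClass F A A]
    (S : NonUnitalSubalgebra F A) (hS_ne : S ≠ ⊥)
    (hS_fin : FiniteDimensional F S) (hS_ss : IsSemisimpleAlg F S)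
    (hA : GeneratedAsIdeal F (S : Set A)) (hS_perf : IsKPerfect F S 1) :
    (∃ 𝔥 : LieSubalgebra F (subCommutator S), 𝔥.IsCartanSubalgebra) ∧
    ∀ 𝔥 : LieSubalgebra F (subCommutator S), 𝔥.IsCartanSubalgebra →
      IsRootGraded (subCommutator S) 𝔥 (gradingWeights S 𝔥) := by
  obtain ⟨ι, _, n, φ, hφ, hn⟩ := hS_ss.exists_bijective_pi_matrix
  have hn2 : ∀ i, 2 ≤ n i := fun i =>
    hS_perf.two_le (hn i)
      ((Pi.evalAlgHom F (fun i => Matrix (Fin (n i)) (Fin (n i)) F) i :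
        (Π i, Matrix (Fin (n i)) (Fin (n i)) F) →ₙₐ[F] _).comp φ) fun X => by
      classical
      obtain ⟨s, hs⟩ := hφ.2 (Pi.single i X)
      refine ⟨s, ?_⟩
      change φ s i = X
      rw [hs, Pi.single_eq_same]
  -- Without components `S` would be zero; a component is also needed to have `0 ∈ Γ`.
  have hι : Nonempty ι := by
    by_contra hempty
    rw [not_nonempty_iff] at hempty
    apply hS_ne
    rw [eq_bot_iff]
    intro s hs
    have h0 : (⟨s, hs⟩ : S) = 0 := hφ.1 (Subsingleton.elim _ _)
    exact NonUnitalAlgebra.mem_bot.mpr (congrArg (fun t : S => (t : A)) h0)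
  have := (isSlCoordinates_subCommutatorCoords hφ).finiteDimensional
  refine ⟨?_, fun 𝔥 h𝔥 => ?_⟩
  · obtain ⟨x, hx⟩ := LieAlgebra.exists_isCartanSubalgebra_engel F (subCommutator S)
    exact ⟨_, hx⟩
  · obtain ⟨φ', hφ', hdiag⟩ := exists_diagonal_coordinates hφ h𝔥
    exact IsDiagonalCartan.isRootGraded ⟨hφ', hn2, h𝔥, hdiag⟩ hA
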